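/- Let $m>0$, and for $s\in(0,1)$ let $$C_s:=\frac{s\,2^{\frac{2s-1}{2}}}{\pi^{3/2}\,\Gamma(1-s)},\qquad \mathcal K_\nu(\zeta):=\frac12\Big(\frac{\zeta}{2}\Big)^{\nu}\int_0^{+\infty}e^{-\frac{\zeta^2}{4t}-t}\,t^{-1-\nu}\,dt\quad(\zeta>0),$$ so that $\mathcal K_\nu$ is the modified Bessel function of the third kind (Macdonald function) of order $\nu$. For $A:\mathbb R^3\to\mathbb R^3$ write $\nabla_A u:=\nabla u-iAu$, with $\nabla u$ the weak gradient, and $$H^1_A(\mathbb R^3,\mathbb C):=\Big\{u\in L^2(\mathbb R^3,\mathbb C): u \text{ has a locally integrable weak gradient and } \int_{\mathbb R^3}|\nabla_A u|^2\,dx<+\infty\Big\}.$$ **Theorem.** Let $A:\mathbb R^3\to\mathbb R^3$ be Lipschitz. Then, for every $u\in H^1_A(\mathbb R^3,\mathbb C)$, the double integral below is finite for every $s\in(0,1)$, and $$\lim_{s\nearrow 1}\frac{C_s}{2}\,m^{\frac{3+2s}{2}}\int_{\mathbb R^3\times\mathbb R^3}\frac{\big|u(x)-e^{i(x-y)\cdot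 A\left(\frac{x+y}{2}\right)}u(y)\big|^2}{|x-y|^{\frac{3+2s}{2}}}\,\mathcal K_{\frac{3+2s}{2}}(m|x-y|)\,dx\,dy=\int_{\mathbb R^3}|\nabla_A u|^2\,dx.$$ -/

import Mathlib

open MeasureTheory Filter Topology
open scoped ContDiff

noncomputable section

namespace MagneticBBM

/-- Three-dimensional Euclidean space. -/
abbrev E3 : Type := EuclideanSpace ℝ (Fin 3)

/-- The modified Bessel function of the third kind (Macdonald function) `K_ν(ζ)`, `ζ > 0`, through
its classical integral representation
`K_ν(ζ) = (1/2) (ζ/2)^ν ∫_0^∞ exp(-ζ²/(4t) - t) t^(-1-ν) dt`. -/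
def besselK (ν ζ : ℝ) : ℝ :=
  (1 / 2) * (ζ / 2) ^ ν *
    ∫ t in Set.Ioi (0 : ℝ), Real.exp (-(ζ ^ 2 / (4 * t)) - t) * t ^ (-1 - ν)

/-- The normalizing constant `C_s = s 2^((2s-1)/2) / (π^(3/2) Γ(1-s))`. -/
def bbmConst (s : ℝ) : ℝ :=
  s * (2 : ℝ) ^ ((2 * s - 1) / 2) / (Real.pi ^ ((3 : ℝ) / 2) * Real.Gamma (1 - s))

/-- `G` is a weak (distributional) gradient of the complex-valued function `u` on `ℝ³`:
both are locally integrable, and `∫ u ∂_j φ = - ∫ G_j φ` for all smooth compactly supported `φ` and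
all `j`. (Real test functions suffice, by linearity.) -/
def HasWeakGradient (u : E3 → ℂ) (G : E3 → EuclideanSpace ℂ (Fin 3)) : Prop :=
  LocallyIntegrable u volume ∧ LocallyIntegrable G volume ∧
    ∀ φ : E3 → ℝ, ContDiff ℝ ∞ φ → HasCompactSupport φ → ∀ j : Fin 3,
      ∫ x, ((fderiv ℝ φ x (EuclideanSpace.single j 1) : ℝ) : ℂ) * u x =
        -∫ x, (φ x : ℂ) * G x j

/-- The covariant gradient `∇_A u = ∇u - i A u`, formed from `u` and its gradient `G = ∇u`. -/
def covariantGradient (A : E3 → E3) (u : E3 → ℂ) (G : E3 → EuclideanSpace ℂ (Fin 3)) (x : E3) :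
    EuclideanSpace ℂ (Fin 3) :=
  WithLp.toLp 2 fun j => G x j - Complex.I * ((A x j : ℝ) : ℂ) * u x

/-- The magnetic Sobolev space `H¹_A(ℝ³, ℂ)`: functions `u ∈ L²` that have a weak gradient `∇u` with
`∇u - i A u ∈ L²`. -/
def magneticH1 (A : E3 → E3) : Set (E3 → ℂ) :=
  {u | MemLp u 2 volume ∧
    ∃ G, HasWeakGradient u G ∧ MemLp (covariantGradient A u G) 2 volume}

/-- The integrand
`|u(x) - exp(i (x-y)·A((x+y)/2)) u(y)|² / |x-y|^((3+2s)/2) · K_((3+2s)/2)(m |x-y|)`. -/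
def gagliardoIntegrand (m : ℝ) (A : E3 → E3) (s : ℝ) (u : E3 → ℂ) (p : E3 × E3) : ℝ :=
  ‖u p.1 - Complex.exp (Complex.I *
      ((inner ℝ (p.1 - p.2) (A ((1 / 2 : ℝ) • (p.1 + p.2))) : ℝ) : ℂ)) * u p.2‖ ^ 2 /
    ‖p.1 - p.2‖ ^ ((3 + 2 * s) / 2) * besselK ((3 + 2 * s) / 2) (m * ‖p.1 - p.2‖)

end MagneticBBM

end

/-! Substitute `x = y + h` and multiply by a unimodular phase. The double integral becomes the
integral over `h` of a radial kernel `k_s(h)` times `P(h)`, the squared `L²` norm in `y` of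
`exp(-ia) u(y+h) - u(y)`, where `a = h · A(y + h/2)`. To first order this difference is `h · D(y)`
with `D = ∇_A u`; let `Q(h)` be the squared `L²` norm of `h · D`.

Three facts give the limit. Each moment of `k_s` is a Gaussian integral followed by a Gamma
integral: after multiplication by the constants of the theorem, the second moment is `3 s m^(2s-2)`,
which tends to 3, and the fourth is `10(1-s)/m²` times the second, so it tends to 0
(`normalized_second_moment`, `fourth_moment_eq`). A radial weight averages `|h · d|²` to
`|h|²|d|²/3`, so the `Q` part tends to the integral of `|D|²` (`integral_radial_energy`). Finally,
for every `ε > 0` there is `C` with `|P(h) - Q(h)| ≤ ε|h|² + C|h|⁴` (`abs_energy_sub_le`). The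
quartic term absorbs all `h` away from 0, where only crude bounds are available.

Near 0 the estimate comes from differentiating `t ↦ exp(-ita) u(y+th)` along almost every segment,
with `a` frozen (`ae_enorm_remainder_sq_le`). The errors are a translation of `D`, controlled by
continuity of translations in `L²`; the factor `exp(-ita) - 1` acting on `D`, controlled by
dominated convergence since `A` may be unbounded; and the variation of `A` along the segment,
controlled by the Lipschitz bound. -/

noncomputable section

namespace MagneticBBM

/-! ### Moments of the Macdonald kernel. -/

/-- The radial kernel `K_ν(m|h|) / |h|^ν`. -/
def macdonaldKernel (m ν : ℝ) (h : E3) : ℝ :=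
  besselK ν (m * ‖h‖) / ‖h‖ ^ ν

lemma gaussian_moment_integrand_eq (b : ℝ) (p : ℕ) :
    Set.EqOn (fun y : ℝ => y ^ (Module.finrank ℝ E3 - 1) • (y ^ p * Real.exp (-b * y ^ 2)))
      (fun y => y ^ ((p : ℝ) + 2) * Real.exp (-b * y ^ 2)) (Set.Ioi 0) := by
  intro y hy
  have hy : 0 < y := hy
  have h3 : Module.finrank ℝ E3 - 1 = 2 := by simp
  simp only [h3, smul_eq_mul]
  rw [Real.rpow_add hy, Real.rpow_natCast]
  norm_num
  ring

lemma integrable_gaussian_moment {b : ℝ} (hb : 0 < b) (p : ℕ) :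
    Integrable (fun h : E3 => ‖h‖ ^ p * Real.exp (-b * ‖h‖ ^ 2)) volume := by
  rw [integrable_fun_norm_addHaar volume (f := fun r : ℝ => r ^ p * Real.exp (-b * r ^ 2))]
  refine IntegrableOn.congr_fun ?_ (gaussian_moment_integrand_eq b p).symm measurableSet_Ioi
  have hp : (0 : ℝ) ≤ p := p.cast_nonneg
  exact integrableOn_rpow_mul_exp_neg_mul_sq hb (by linarith)

lemma integral_gaussian_moment {b : ℝ} (hb : 0 < b) (p : ℕ) :
    ∫ h : E3, ‖h‖ ^ p * Real.exp (-b * ‖h‖ ^ 2) =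
      2 * Real.pi * Real.Gamma ((3 + p) / 2) * b ^ (-((3 + (p : ℝ)) / 2)) := by
  have hp : (0 : ℝ) ≤ p := p.cast_nonneg
  rw [integral_fun_norm_addHaar volume (fun r : ℝ => r ^ p * Real.exp (-b * r ^ 2)),
    setIntegral_congr_fun measurableSet_Ioi (gaussian_moment_integrand_eq b p)]
  have h := integral_rpow_mul_exp_neg_mul_rpow (p := 2) (q := p + 2) (b := b) two_pos
    (by linarith) hb
  -- The sphere area is three times the ball volume, `4π`; the one-dimensional integral contributes
  -- a further `1/2`.
  have hv : volume.real (Metric.ball (0 : E3) 1) = Real.pi * 4 / 3 := by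
    rw [Measure.real, EuclideanSpace.volume_ball_fin_three]
    simp only [ENNReal.ofReal_one, one_pow, one_mul]
    exact ENNReal.toReal_ofReal (by positivity)
  simp only [Real.rpow_two] at h
  rw [h, hv, finrank_euclideanSpace_fin, show -((p : ℝ) + 2 + 1) / 2 = -((3 + p) / 2) by ring,
    show ((p : ℝ) + 2 + 1) / 2 = (3 + p) / 2 by ring]
  simp only [nsmul_eq_mul, smul_eq_mul]
  push_cast
  ring

lemma macdonaldKernel_nonneg {m : ℝ} (hm : 0 < m) (ν : ℝ) (h : E3) :
    0 ≤ macdonaldKernel m ν h := by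
  unfold macdonaldKernel besselK
  have : 0 ≤ ∫ t in Set.Ioi (0 : ℝ),
      Real.exp (-((m * ‖h‖) ^ 2 / (4 * t)) - t) * t ^ (-1 - ν) := by
    refine setIntegral_nonneg measurableSet_Ioi fun t ht => ?_
    have ht : 0 < t := ht
    positivity
  positivity

lemma measurable_macdonaldKernel (m ν : ℝ) : Measurable (macdonaldKernel m ν) := by
  unfold macdonaldKernel besselK
  have : StronglyMeasurable fun h : E3 => ∫ t in Set.Ioi (0 : ℝ),
      Real.exp (-((m * ‖h‖) ^ 2 / (4 * t)) - t) * t ^ (-1 - ν) := by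
    refine StronglyMeasurable.integral_prod_right
      (f := fun (h : E3) (t : ℝ) => Real.exp (-((m * ‖h‖) ^ 2 / (4 * t)) - t) * t ^ (-1 - ν)) ?_
    apply Measurable.stronglyMeasurable
    unfold Function.uncurry
    fun_prop
  have := this.measurable
  fun_prop

/-- For fixed `t` the `h`-integral is a Gaussian moment with parameter `(m/2)²/t`; the resulting
power of `t` turns the `t`-integral into a Gamma integral, convergent exactly under `hν`. -/
lemma integrable_kernel_prod {m ν : ℝ} (hm : 0 < m) (p : ℕ) (hν : ν < (3 + p) / 2) :
    Integrable (fun q : E3 × ℝ =>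
      ‖q.1‖ ^ p * (Real.exp (-((m * ‖q.1‖) ^ 2 / (4 * q.2)) - q.2) * q.2 ^ (-1 - ν)))
      (volume.prod (volume.restrict (Set.Ioi (0 : ℝ)))) ∧
    ∫ t in Set.Ioi (0 : ℝ), ∫ h : E3,
      ‖h‖ ^ p * (Real.exp (-((m * ‖h‖) ^ 2 / (4 * t)) - t) * t ^ (-1 - ν)) =
      2 * Real.pi * Real.Gamma ((3 + p) / 2) * (m / 2) ^ (-(3 + (p : ℝ))) *
        Real.Gamma ((3 + p) / 2 - ν) := by
  set c : ℝ := 2 * Real.pi * Real.Gamma ((3 + p) / 2) * (m / 2) ^ (-(3 + (p : ℝ))) with hc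
  have key : ∀ t : ℝ, 0 < t → ∀ h : E3,
      ‖h‖ ^ p * (Real.exp (-((m * ‖h‖) ^ 2 / (4 * t)) - t) * t ^ (-1 - ν)) =
      (‖h‖ ^ p * Real.exp (-((m / 2) ^ 2 / t) * ‖h‖ ^ 2)) * (Real.exp (-t) * t ^ (-1 - ν)) := by
    intro t ht h
    rw [sub_eq_add_neg, Real.exp_add]
    have : -((m * ‖h‖) ^ 2 / (4 * t)) = -((m / 2) ^ 2 / t) * ‖h‖ ^ 2 := by field_simp; ring
    rw [this]
    ring
  have hb : ∀ t : ℝ, 0 < t → 0 < (m / 2) ^ 2 / t := fun t ht => by positivity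
  have inner : ∀ t : ℝ, 0 < t → ∫ h : E3,
      ‖h‖ ^ p * (Real.exp (-((m * ‖h‖) ^ 2 / (4 * t)) - t) * t ^ (-1 - ν)) =
      c * (Real.exp (-t) * t ^ ((3 + p) / 2 - ν - 1)) := by
    intro t ht
    simp_rw [key t ht]
    rw [integral_mul_const, integral_gaussian_moment (hb t ht),
      Real.div_rpow (by positivity) ht.le, ← Real.rpow_natCast (m / 2) 2, ← Real.rpow_mul
        (by positivity), hc, Real.rpow_neg ht.le ((3 + p) / 2),
      show ((3 + (p : ℝ)) / 2 - ν - 1) = (3 + p) / 2 + (-1 - ν) by ring, Real.rpow_add ht]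
    rw [show (((2 : ℕ) : ℝ) * -((3 + (p : ℝ)) / 2)) = -(3 + p) by push_cast; ring]
    field_simp
  have hG := Real.GammaIntegral_convergent (s := (3 + p) / 2 - ν) (by linarith)
  constructor
  · rw [integrable_prod_iff']
    · constructor
      · filter_upwards [ae_restrict_mem measurableSet_Ioi] with t ht
        simp_rw [key t ht]
        exact (integrable_gaussian_moment (hb t ht) p).mul_const _
      · refine IntegrableOn.congr_fun (hG.const_mul c) ?_ measurableSet_Ioi
        intro t ht
        have ht : 0 < t := ht
        simp only
        rw [← inner t ht]
        refine integral_congr_ae (Eventually.of_forall fun h => ?_)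
        exact (Real.norm_of_nonneg (by positivity)).symm
    · apply Measurable.aestronglyMeasurable
      fun_prop
  · rw [setIntegral_congr_fun measurableSet_Ioi (fun t ht => inner t ht), integral_const_mul,
      Real.Gamma_eq_integral (by linarith)]

lemma kernel_moment {m ν : ℝ} (hm : 0 < m) (p : ℕ) (hν : ν < (3 + p) / 2) :
    Integrable (fun h : E3 => macdonaldKernel m ν h * ‖h‖ ^ p) volume ∧
    ∫ h : E3, macdonaldKernel m ν h * ‖h‖ ^ p =
      1 / 2 * (m / 2) ^ (ν - (3 + p)) * (2 * Real.pi * Real.Gamma ((3 + p) / 2) *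
        Real.Gamma ((3 + p) / 2 - ν)) := by
  obtain ⟨hI, hE⟩ := integrable_kernel_prod hm p hν
  have hae : (fun h : E3 => 1 / 2 * (m / 2) ^ ν * ∫ t in Set.Ioi (0 : ℝ),
      ‖h‖ ^ p * (Real.exp (-((m * ‖h‖) ^ 2 / (4 * t)) - t) * t ^ (-1 - ν))) =ᵐ[volume]
      fun h => macdonaldKernel m ν h * ‖h‖ ^ p := by
    -- Away from the origin the factor `‖h‖ ^ ν` of `besselK` cancels the denominator of the kernel.
    have h0 : ∀ᵐ h : E3, h ≠ 0 := by simp [ae_iff]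
    filter_upwards [h0] with h hh
    have hh : 0 < ‖h‖ := norm_pos_iff.2 hh
    rw [integral_const_mul, macdonaldKernel, besselK,
      show m * ‖h‖ / 2 = m / 2 * ‖h‖ by ring, Real.mul_rpow (by positivity) hh.le]
    have := (Real.rpow_pos_of_pos hh ν).ne'
    field_simp
  refine ⟨(hI.integral_prod_left.const_mul _).congr hae, ?_⟩
  rw [← integral_congr_ae hae, integral_const_mul, integral_integral_swap hI, hE,
    sub_eq_add_neg ν, Real.rpow_add (by positivity)]
  ring

lemma integrable_kernel_sq {m s : ℝ} (hm : 0 < m) (hs : s < 1) :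
    Integrable (fun h : E3 => macdonaldKernel m ((3 + 2 * s) / 2) h * ‖h‖ ^ 2) volume :=
  (kernel_moment hm 2 (by push_cast; linarith)).1

lemma integrable_kernel_four {m s : ℝ} (hm : 0 < m) (hs : s < 1) :
    Integrable (fun h : E3 => macdonaldKernel m ((3 + 2 * s) / 2) h * ‖h‖ ^ 4) volume :=
  (kernel_moment hm 4 (by push_cast; linarith)).1

lemma normalized_second_moment {m s : ℝ} (hm : 0 < m) (hs : s < 1) :
    bbmConst s / 2 * m ^ ((3 + 2 * s) / 2) *
      ∫ h : E3, macdonaldKernel m ((3 + 2 * s) / 2) h * ‖h‖ ^ 2 = 3 * s * m ^ (2 * s - 2) := by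
  have hΓ : Real.Gamma (1 - s) ≠ 0 := (Real.Gamma_pos_of_pos (by linarith)).ne'
  have h52 : Real.Gamma (5 / 2) = 3 / 4 * Real.pi ^ ((1 : ℝ) / 2) := by
    rw [show (5 / 2 : ℝ) = 1 / 2 + 1 + 1 by norm_num, Real.Gamma_add_one (by norm_num),
      Real.Gamma_add_one (by norm_num), Real.Gamma_one_half_eq, Real.sqrt_eq_rpow]
    ring
  have hπ : Real.pi * Real.pi ^ ((1 : ℝ) / 2) = Real.pi ^ ((3 : ℝ) / 2) := by
    rw [show (3 / 2 : ℝ) = 1 + 1 / 2 by norm_num, Real.rpow_add Real.pi_pos, Real.rpow_one]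
  have hπ' := (Real.rpow_pos_of_pos Real.pi_pos (3 / 2)).ne'
  have h2 : (2 : ℝ) ^ ((2 * s - 1) / 2) = 8 * (2 : ℝ) ^ ((3 + 2 * s) / 2 - (3 + 2)) := by
    rw [show (8 : ℝ) = 2 ^ (3 : ℝ) by norm_num, ← Real.rpow_add two_pos]
    congr 1
    ring
  have h2' := (Real.rpow_pos_of_pos (two_pos (α := ℝ)) ((3 + 2 * s) / 2 - (3 + 2))).ne'
  have hmm : m ^ (2 * s - 2) = m ^ ((3 + 2 * s) / 2) * m ^ ((3 + 2 * s) / 2 - (3 + 2)) := by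
    rw [← Real.rpow_add hm]
    congr 1
    ring
  rw [(kernel_moment hm 2 (by push_cast; linarith)).2, bbmConst, Real.div_rpow hm.le two_pos.le]
  push_cast
  rw [show ((3 : ℝ) + 2) / 2 - (3 + 2 * s) / 2 = 1 - s by ring,
    show ((3 : ℝ) + 2) / 2 = 5 / 2 by norm_num, h52, hmm, ← hπ, h2]
  rw [← hπ] at hπ'
  have h8 := left_ne_zero_of_mul hπ'
  have h9 := right_ne_zero_of_mul hπ'
  field_simp
  ring

/-- Raising the exponent from 2 to 4 moves the Gamma argument from `1 - s` to `2 - s`, which yields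
the vanishing factor `1 - s`; the rest is `(5/2) (m/2)^(-2) = 10/m²`. -/
lemma fourth_moment_eq {m s : ℝ} (hm : 0 < m) (hs : s < 1) :
    ∫ h : E3, macdonaldKernel m ((3 + 2 * s) / 2) h * ‖h‖ ^ 4 =
      10 * (1 - s) / m ^ 2 * ∫ h : E3, macdonaldKernel m ((3 + 2 * s) / 2) h * ‖h‖ ^ 2 := by
  rw [(kernel_moment hm 2 (by push_cast; linarith)).2,
    (kernel_moment hm 4 (by push_cast; linarith)).2]
  push_cast
  rw [show ((3 : ℝ) + 4) / 2 - (3 + 2 * s) / 2 = (1 - s) + 1 by ring,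
    Real.Gamma_add_one (by linarith), show ((3 : ℝ) + 2) / 2 - (3 + 2 * s) / 2 = 1 - s by ring,
    show ((3 : ℝ) + 4) / 2 = (3 + 2) / 2 + 1 by norm_num, Real.Gamma_add_one (by norm_num),
    show (3 + 2 * s) / 2 - (3 + 4) = ((3 + 2 * s) / 2 - (3 + 2)) + (-2) by ring,
    Real.rpow_add (by positivity), Real.rpow_neg (by positivity), Real.rpow_two]
  field_simp
  ring

lemma tendsto_normalized_second_moment {m : ℝ} (hm : 0 < m) :
    Tendsto (fun s : ℝ => bbmConst s / 2 * m ^ ((3 + 2 * s) / 2) *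
      ∫ h : E3, macdonaldKernel m ((3 + 2 * s) / 2) h * ‖h‖ ^ 2) (𝓝[<] 1) (𝓝 3) := by
  have hc : Continuous fun s : ℝ => 3 * s * m ^ (2 * s - 2) :=
    (continuous_const.mul continuous_id).mul
      (Continuous.rpow continuous_const (by fun_prop) fun _ => Or.inl hm.ne')
  have h1 : Tendsto (fun s : ℝ => 3 * s * m ^ (2 * s - 2)) (𝓝[<] 1) (𝓝 3) := by
    have := (hc.tendsto 1).mono_left (nhdsWithin_le_nhds (s := Set.Iio 1))
    simpa using this
  refine h1.congr' ?_
  filter_upwards [self_mem_nhdsWithin] with s hs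
  exact (normalized_second_moment hm hs).symm

lemma tendsto_normalized_fourth_moment {m : ℝ} (hm : 0 < m) :
    Tendsto (fun s : ℝ => bbmConst s / 2 * m ^ ((3 + 2 * s) / 2) *
      ∫ h : E3, macdonaldKernel m ((3 + 2 * s) / 2) h * ‖h‖ ^ 4) (𝓝[<] 1) (𝓝 0) := by
  have h1 : Tendsto (fun s : ℝ => 10 * (1 - s) / m ^ 2) (𝓝[<] 1) (𝓝 0) := by
    have : Continuous fun s : ℝ => 10 * (1 - s) / m ^ 2 := by fun_prop
    simpa using (this.tendsto 1).mono_left (nhdsWithin_le_nhds (s := Set.Iio 1))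
  have h2 := h1.mul (tendsto_normalized_second_moment hm)
  rw [zero_mul] at h2
  refine h2.congr' ?_
  filter_upwards [self_mem_nhdsWithin] with s hs
  rw [fourth_moment_eq hm hs]
  ring

/-! ### Isotropic averaging of the directional energy. -/

/-- The bilinear pairing `h · d` of a real vector with a complex vector. -/
def dirPairing (h : E3) (d : EuclideanSpace ℂ (Fin 3)) : ℂ :=
  ∑ j, (h j : ℂ) * d j

lemma norm_dirPairing_le (h : E3) (d : EuclideanSpace ℂ (Fin 3)) :
    ‖dirPairing h d‖ ≤ ‖h‖ * ‖d‖ := by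
  refine abs_le_of_sq_le_sq' ?_ (by positivity) |>.2
  have h1 : ‖dirPairing h d‖ ≤ ∑ j, ‖h j‖ * ‖d j‖ := by
    refine (norm_sum_le _ _).trans (Finset.sum_le_sum fun j _ => ?_)
    rw [norm_mul, Complex.norm_real]
  calc ‖dirPairing h d‖ ^ 2 ≤ (∑ j, ‖h j‖ * ‖d j‖) ^ 2 := by gcongr
    _ ≤ (∑ j, ‖h j‖ ^ 2) * ∑ j, ‖d j‖ ^ 2 := Finset.sum_mul_sq_le_sq_mul_sq _ _ _
    _ = (‖h‖ * ‖d‖) ^ 2 := by rw [mul_pow, EuclideanSpace.norm_sq_eq, EuclideanSpace.norm_sq_eq]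

lemma dirPairing_sub (h : E3) (d e : EuclideanSpace ℂ (Fin 3)) :
    dirPairing h (d - e) = dirPairing h d - dirPairing h e := by
  simp [dirPairing, mul_sub, Finset.sum_sub_distrib]

lemma continuous_dirPairing :
    Continuous fun q : E3 × EuclideanSpace ℂ (Fin 3) => dirPairing q.1 q.2 := by
  unfold dirPairing
  fun_prop

lemma norm_sq_dirPairing (h : E3) (d : EuclideanSpace ℂ (Fin 3)) :
    ‖dirPairing h d‖ ^ 2 =
      inner ℝ h (WithLp.toLp 2 fun j => (d j).re : E3) ^ 2 +
        inner ℝ h (WithLp.toLp 2 fun j => (d j).im : E3) ^ 2 := by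
  rw [Complex.sq_norm, Complex.normSq_apply]
  simp [dirPairing, PiLp.inner_apply, Fin.sum_univ_three]
  ring

lemma abs_inner_sq_le (h v : E3) : inner ℝ h v ^ 2 ≤ ‖h‖ ^ 2 * ‖v‖ ^ 2 := by
  rw [← mul_pow, ← sq_abs]
  exact pow_le_pow_left₀ (abs_nonneg _) (abs_real_inner_le_norm h v) 2

lemma integrable_radial_inner_sq {k : E3 → ℝ} (hk : Measurable k)
    (hI : Integrable (fun h => k h * ‖h‖ ^ 2) volume) (v : E3) :
    Integrable (fun h => k h * inner ℝ h v ^ 2) volume := by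
  refine (hI.mul_const (‖v‖ ^ 2)).mono (by fun_prop) (Eventually.of_forall fun h => ?_)
  simp only [norm_mul, norm_pow, norm_norm, mul_assoc]
  gcongr
  rw [← norm_pow, Real.norm_of_nonneg (sq_nonneg _)]
  exact abs_inner_sq_le h v

/-- The reflection in the hyperplane orthogonal to `v - w` exchanges `v` and `w`, and it preserves
both Lebesgue measure and radial functions. -/
lemma integral_radial_inner_sq_eq_of_norm_eq {k : E3 → ℝ}
    (hr : ∀ h h' : E3, ‖h‖ = ‖h'‖ → k h = k h') {v w : E3} (hvw : ‖v‖ = ‖w‖) :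
    ∫ h, k h * inner ℝ h v ^ 2 = ∫ h, k h * inner ℝ h w ^ 2 := by
  set R := (Submodule.span ℝ {v - w})ᗮ.reflection with hR
  have hRv : R v = w := Submodule.reflection_sub hvw
  rw [← (R.measurePreserving).integral_comp R.toHomeomorph.measurableEmbedding
    (fun h => k h * inner ℝ h w ^ 2)]
  refine integral_congr_ae (Eventually.of_forall fun h => ?_)
  simp only
  rw [hr (R h) h (R.norm_map h), ← hRv, R.inner_map_map]

/-- By rotation invariance each coordinate direction contributes equally, and the three
contributions add up to the full second moment. -/
lemma integral_radial_inner_sq {k : E3 → ℝ} (hk : Measurable k)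
    (hr : ∀ h h' : E3, ‖h‖ = ‖h'‖ → k h = k h')
    (hI : Integrable (fun h => k h * ‖h‖ ^ 2) volume) (v : E3) :
    ∫ h, k h * inner ℝ h v ^ 2 = ‖v‖ ^ 2 * ((∫ h, k h * ‖h‖ ^ 2) / 3) := by
  have hsc : ∀ j : Fin 3, ∫ h, k h * inner ℝ h v ^ 2 =
      ‖v‖ ^ 2 * ∫ h, k h * inner ℝ h (EuclideanSpace.single j (1 : ℝ)) ^ 2 := by
    intro j
    rw [integral_radial_inner_sq_eq_of_norm_eq hr
      (w := ‖v‖ • EuclideanSpace.single j (1 : ℝ)) (by simp [norm_smul]), ← integral_const_mul]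
    refine integral_congr_ae (Eventually.of_forall fun h => ?_)
    simp only [inner_smul_right]
    ring
  have hsum : ∑ j : Fin 3, ∫ h, k h * inner ℝ h (EuclideanSpace.single j (1 : ℝ)) ^ 2 =
      ∫ h, k h * ‖h‖ ^ 2 := by
    rw [← integral_finsetSum _ fun j _ => integrable_radial_inner_sq hk hI _]
    refine integral_congr_ae (Eventually.of_forall fun h => ?_)
    simp only
    rw [← Finset.mul_sum, EuclideanSpace.norm_sq_eq]
    simp [EuclideanSpace.inner_single_right]
  rw [← hsum, mul_div_assoc', Finset.mul_sum, Finset.sum_congr rfl fun j _ => (hsc j).symm]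
  simp

lemma integral_radial_dirPairing_sq {k : E3 → ℝ} (hk : Measurable k)
    (hr : ∀ h h' : E3, ‖h‖ = ‖h'‖ → k h = k h')
    (hI : Integrable (fun h => k h * ‖h‖ ^ 2) volume) (d : EuclideanSpace ℂ (Fin 3)) :
    ∫ h, k h * ‖dirPairing h d‖ ^ 2 = ‖d‖ ^ 2 * ((∫ h, k h * ‖h‖ ^ 2) / 3) := by
  simp_rw [norm_sq_dirPairing, mul_add]
  rw [integral_add (integrable_radial_inner_sq hk hI _) (integrable_radial_inner_sq hk hI _),
    integral_radial_inner_sq hk hr hI, integral_radial_inner_sq hk hr hI, ← add_mul]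
  congr 1
  simp only [EuclideanSpace.norm_sq_eq, ← Finset.sum_add_distrib]
  refine Finset.sum_congr rfl fun j _ => ?_
  rw [Complex.sq_norm, Complex.normSq_apply]
  simp only [Real.norm_eq_abs, sq_abs]
  ring

lemma integrable_dirPairing_sq {D : E3 → EuclideanSpace ℂ (Fin 3)} (hD : MemLp D 2 volume)
    (h : E3) : Integrable (fun x => ‖dirPairing h (D x)‖ ^ 2) volume := by
  refine (hD.integrable_norm_pow two_ne_zero |>.const_mul (‖h‖ ^ 2)).mono ?_
    (Eventually.of_forall fun x => ?_)
  · exact ((continuous_dirPairing.comp (Continuous.prodMk_right h)).comp_aestronglyMeasurable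
      hD.1).norm.pow 2
  · rw [Real.norm_of_nonneg (by positivity), Real.norm_of_nonneg (by positivity), ← mul_pow]
    gcongr
    exact norm_dirPairing_le _ _

lemma integral_dirPairing_sq_le {D : E3 → EuclideanSpace ℂ (Fin 3)} (hD : MemLp D 2 volume)
    (h : E3) : ∫ x, ‖dirPairing h (D x)‖ ^ 2 ≤ ‖h‖ ^ 2 * ∫ x, ‖D x‖ ^ 2 := by
  rw [← integral_const_mul]
  refine integral_mono (integrable_dirPairing_sq hD h)
    ((hD.integrable_norm_pow two_ne_zero).const_mul _) fun x => ?_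
  simp only
  rw [← mul_pow]
  gcongr
  exact norm_dirPairing_le _ _

/-- After Fubini the isotropic average applies to the constant vector `D x` at each fixed `x`. -/
lemma integral_radial_energy {k : E3 → ℝ} (hk : Measurable k)
    (hr : ∀ h h' : E3, ‖h‖ = ‖h'‖ → k h = k h')
    (hI : Integrable (fun h => k h * ‖h‖ ^ 2) volume)
    {D : E3 → EuclideanSpace ℂ (Fin 3)} (hD : MemLp D 2 volume) :
    Integrable (fun h => k h * ∫ x, ‖dirPairing h (D x)‖ ^ 2) volume ∧
    ∫ h, k h * ∫ x, ‖dirPairing h (D x)‖ ^ 2 =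
      (∫ h, k h * ‖h‖ ^ 2) / 3 * ∫ x, ‖D x‖ ^ 2 := by
  have hprod : Integrable (Function.uncurry fun (h x : E3) => k h * ‖dirPairing h (D x)‖ ^ 2)
      (volume.prod volume) := by
    refine (hI.mul_prod (hD.integrable_norm_pow two_ne_zero)).mono ?_
      (Eventually.of_forall fun q => ?_)
    · refine AEStronglyMeasurable.mul (hk.comp measurable_fst).aestronglyMeasurable ?_
      exact (continuous_dirPairing.comp_aestronglyMeasurable
        (measurable_fst.aestronglyMeasurable.prodMk hD.1.comp_snd)).norm.pow 2
    · simp only [Function.uncurry, norm_mul, norm_pow, norm_norm, mul_assoc]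
      rw [← mul_pow]
      gcongr
      exact norm_dirPairing_le _ _
  have h1 : Integrable (fun h => ∫ x, k h * ‖dirPairing h (D x)‖ ^ 2) volume :=
    hprod.integral_prod_left
  simp_rw [← integral_const_mul (k _)]
  refine ⟨h1, ?_⟩
  rw [integral_integral_swap hprod]
  simp_rw [integral_radial_dirPairing_sq hk hr hI]
  rw [integral_mul_const, mul_comm]

/-! ### Weak gradients along lines. -/

lemma locallyIntegrable_dirPairing {G : E3 → EuclideanSpace ℂ (Fin 3)}
    (hG : LocallyIntegrable G volume) (h : E3) :
    LocallyIntegrable (fun z => dirPairing h (G z)) volume := by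
  intro x
  obtain ⟨U, hU, hI⟩ := hG x
  refine ⟨U, hU, (hI.norm.const_mul ‖h‖).mono' ?_ (Eventually.of_forall fun z =>
    norm_dirPairing_le h (G z))⟩
  exact (continuous_dirPairing.comp (Continuous.prodMk_right h)).comp_aestronglyMeasurable hI.1

lemma integral_fderiv_smul_eq {u : E3 → ℂ} {G : E3 → EuclideanSpace ℂ (Fin 3)}
    (hw : HasWeakGradient u G) {φ : E3 → ℝ} (hφ : ContDiff ℝ ∞ φ) (hc : HasCompactSupport φ)
    (h : E3) :
    ∫ x, fderiv ℝ φ x h • u x = -∫ x, φ x • dirPairing h (G x) := by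
  obtain ⟨hu, hG, hw⟩ := hw
  have hh : h = ∑ j, h j • EuclideanSpace.single j (1 : ℝ) := by
    ext i
    simp [Finset.sum_apply, Pi.single_apply]
  have hcd : Continuous (fderiv ℝ φ) := hφ.continuous_fderiv (by simp)
  have e1 : ∀ x, fderiv ℝ φ x h • u x =
      ∑ j, (h j : ℂ) * (((fderiv ℝ φ x (EuclideanSpace.single j 1) : ℝ) : ℂ) * u x) := by
    intro x
    conv_lhs => rw [hh]
    simp only [map_sum, map_smul, Finset.sum_smul, smul_eq_mul, Complex.real_smul,
      Complex.ofReal_mul, mul_assoc]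
  have e2 : ∀ x, φ x • dirPairing h (G x) = ∑ j, (h j : ℂ) * ((φ x : ℂ) * G x j) := by
    intro x
    simp only [dirPairing, Finset.smul_sum, Complex.real_smul]
    exact Finset.sum_congr rfl fun j _ => by ring
  simp_rw [e1, e2]
  rw [integral_finsetSum, integral_finsetSum, ← Finset.sum_neg_distrib]
  · refine Finset.sum_congr rfl fun j _ => ?_
    rw [integral_const_mul, integral_const_mul, hw φ hφ hc j, mul_neg]
  · intro j _
    refine Integrable.const_mul ?_ _
    have : LocallyIntegrable (fun x => G x j) volume := by
      simpa [dirPairing, Pi.single_apply, apply_ite Complex.ofReal] using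
        locallyIntegrable_dirPairing hG (EuclideanSpace.single j (1 : ℝ))
    simpa only [Complex.real_smul] using
      this.integrable_smul_left_of_hasCompactSupport hφ.continuous hc
  · intro j _
    refine Integrable.const_mul ?_ _
    simpa only [Complex.real_smul] using
      hu.integrable_smul_left_of_hasCompactSupport
        (g := fun x => fderiv ℝ φ x (EuclideanSpace.single j 1)) (by fun_prop)
        (hc.fderiv_apply ℝ _)

/-- Viewing the pairing with a translate as a convolution makes it continuous, and differentiable,
in the translation. -/
lemma convolution_reflected_eq (φ : E3 → ℝ) (f : E3 → ℂ) (x : E3) :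
    (convolution f (fun z => φ (-z)) (ContinuousLinearMap.lsmul ℝ ℝ).flip volume) x =
      ∫ y, φ y • f (y + x) := by
  rw [convolution_def, ← integral_add_right_eq_self _ x]
  simp

lemma continuous_integral_test_translate {f : E3 → ℂ} (hf : LocallyIntegrable f volume)
    {φ : E3 → ℝ} (hφ : Continuous φ) (hc : HasCompactSupport φ) :
    Continuous fun x => ∫ y, φ y • f (y + x) := by
  simp_rw [← convolution_reflected_eq]
  exact HasCompactSupport.continuous_convolution_right _
    (hc.comp_homeomorph (Homeomorph.neg E3)) hf (by fun_prop)

/-- Differentiating the convolution puts the derivative on the test function; the weak gradient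
identity for the translated test function `χ` moves it back onto `u`. -/
lemma hasDerivAt_integral_test_line {u : E3 → ℂ} {G : E3 → EuclideanSpace ℂ (Fin 3)}
    (hw : HasWeakGradient u G) {φ : E3 → ℝ} (hφ : ContDiff ℝ ∞ φ) (hc : HasCompactSupport φ)
    (h : E3) (t : ℝ) :
    HasDerivAt (fun t : ℝ => ∫ y, φ y • u (y + t • h))
      (∫ y, φ y • dirPairing h (G (y + t • h))) t := by
  set ψ : E3 → ℝ := fun z => φ (-z) with hψ
  have hcψ : HasCompactSupport ψ := hc.comp_homeomorph (Homeomorph.neg E3)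
  have hdψ : ContDiff ℝ ∞ ψ := hφ.comp contDiff_neg
  have hcdψ : Continuous (fderiv ℝ ψ) := hdψ.continuous_fderiv (by simp)
  have hF := hcψ.hasFDerivAt_convolution_right (μ := volume)
    (ContinuousLinearMap.lsmul ℝ ℝ (E := ℂ)).flip hw.1 (hdψ.of_le (by simp)) (t • h)
  have hl : HasDerivAt (fun t : ℝ => t • h) h t := by
    simpa using (hasDerivAt_id t).smul_const h
  have hD := hF.comp_hasDerivAt t hl
  rw [convolution_precompR_apply _ hw.1 (hcψ.fderiv ℝ) hcdψ] at hD
  have e : (fun t : ℝ => ∫ y, φ y • u (y + t • h)) =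
      (convolution u ψ (ContinuousLinearMap.lsmul ℝ ℝ (E := ℂ)).flip volume) ∘ fun t : ℝ =>
        t • h := by
    funext t
    exact (convolution_reflected_eq φ u (t • h)).symm
  rw [e]
  refine hD.congr_deriv ?_
  have hfd : ∀ z, fderiv ℝ ψ z h = -fderiv ℝ φ (-z) h := by
    intro z
    have : HasFDerivAt ψ ((fderiv ℝ φ (-z)).comp (-ContinuousLinearMap.id ℝ E3)) z :=
      ((hφ.differentiable (by simp)) (-z)).hasFDerivAt.comp z (hasFDerivAt_id z).neg
    rw [this.fderiv]
    simp
  set χ : E3 → ℝ := fun z => φ (z - t • h) with hχ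
  have hχd : ContDiff ℝ ∞ χ := hφ.comp (contDiff_id.sub contDiff_const)
  have hχc : HasCompactSupport χ := hc.comp_homeomorph (Homeomorph.subRight (t • h))
  have := integral_fderiv_smul_eq hw hχd hχc h
  have hfx : ∀ z, fderiv ℝ χ z h = fderiv ℝ φ (z - t • h) h := by
    intro z
    have : HasFDerivAt χ ((fderiv ℝ φ (z - t • h)).comp (ContinuousLinearMap.id ℝ E3)) z :=
      ((hφ.differentiable (by simp)) (z - t • h)).hasFDerivAt.comp z
        ((hasFDerivAt_id z).sub_const (t • h))
    rw [this.fderiv]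
    simp
  rw [convolution_def]
  simp only [ContinuousLinearMap.flip_apply, ContinuousLinearMap.lsmul_apply, hfd, neg_sub]
  simp only [hfx] at this
  simp only [neg_smul, integral_neg, this, neg_neg]
  rw [← integral_add_right_eq_self (fun y => χ y • dirPairing h (G y)) (t • h)]
  simp [hχ]

/-- Segments issuing from `K` sweep out a compact set `K'`, and translation invariance bounds every
slice by the integral over `K'`. -/
lemma integrable_segment_translate {F : Type*} [NormedAddCommGroup F] {f : E3 → F}
    (hm : StronglyMeasurable f) (hf : LocallyIntegrable f volume) (h : E3) {K : Set E3}
    (hK : IsCompact K) :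
    Integrable (fun q : E3 × ℝ => f (q.1 + q.2 • h))
      ((volume.restrict K).prod (volume.restrict (Set.Ioc (0 : ℝ) 1))) := by
  have hmeas : StronglyMeasurable fun q : E3 × ℝ => f (q.1 + q.2 • h) :=
    hm.comp_measurable (by fun_prop)
  refine ⟨hmeas.aestronglyMeasurable, ?_⟩
  set K' : Set E3 := (fun q : E3 × ℝ => q.1 + q.2 • h) '' (K ×ˢ Set.Icc (0 : ℝ) 1) with hK'
  have hK'c : IsCompact K' := (hK.prod isCompact_Icc).image (by fun_prop)
  have hfin : ∫⁻ z in K', ‖f z‖ₑ < ⊤ := (locallyIntegrable_iff.1 hf K' hK'c).2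
  rw [HasFiniteIntegral, lintegral_prod_symm' _ hmeas.enorm]
  calc ∫⁻ r in Set.Ioc (0 : ℝ) 1, ∫⁻ y in K, ‖f (y + r • h)‖ₑ
      ≤ ∫⁻ r in Set.Ioc (0 : ℝ) 1, ∫⁻ z in K', ‖f z‖ₑ := by
        refine lintegral_mono_ae ?_
        filter_upwards [ae_restrict_mem measurableSet_Ioc] with r hr
        rw [← lintegral_indicator hK.measurableSet, ← lintegral_indicator hK'c.measurableSet,
          ← lintegral_add_right_eq_self (K'.indicator fun z => ‖f z‖ₑ) (r • h)]
        refine lintegral_mono fun y => ?_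
        by_cases hy : y ∈ K
        · rw [Set.indicator_of_mem hy, Set.indicator_of_mem]
          exact ⟨(y, r), ⟨hy, hr.1.le, hr.2⟩, rfl⟩
        · rw [Set.indicator_of_notMem hy]
          exact zero_le
    _ = ∫⁻ z in K', ‖f z‖ₑ := by simp
    _ < ⊤ := hfin

lemma segment_restrict {F : Type*} [NormedAddCommGroup F] {f : E3 → F}
    (hm : StronglyMeasurable f) (hf : LocallyIntegrable f volume) (h : E3) {K : Set E3}
    (hK : IsCompact K) {t : ℝ} (ht : t ≤ 1) :
    Integrable (fun q : E3 × ℝ => f (q.1 + q.2 • h))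
      ((volume.restrict K).prod (volume.restrict (Set.Ioc (0 : ℝ) t))) := by
  refine (integrable_segment_translate hm hf h hK).mono_measure ?_
  rw [Measure.prod_restrict, Measure.prod_restrict]
  exact Measure.restrict_mono (Set.prod_mono le_rfl (Set.Ioc_subset_Ioc_right ht)) le_rfl

lemma integrable_test_segment {f : E3 → ℂ} (hm : StronglyMeasurable f)
    (hf : LocallyIntegrable f volume) (h : E3) {φ : E3 → ℝ} (hφ : Continuous φ)
    (hc : HasCompactSupport φ) {t : ℝ} (ht : t ≤ 1) :
    Integrable (fun q : E3 × ℝ => φ q.1 • f (q.1 + q.2 • h))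
      (volume.prod (volume.restrict (Set.Ioc (0 : ℝ) t))) := by
  rw [← integrableOn_iff_integrable_of_support_subset (s := tsupport φ ×ˢ Set.univ), IntegrableOn,
    ← Measure.restrict_prod_eq_prod_univ]
  · obtain ⟨C, hC⟩ := hφ.bounded_above_of_compact_support hc
    exact (segment_restrict hm hf h hc ht).bdd_smul C
      ((hφ.comp continuous_fst).aestronglyMeasurable) (Eventually.of_forall fun q => hC q.1)
  · intro q hq
    refine ⟨subset_tsupport φ ?_, trivial⟩
    intro h0
    exact hq (by simp [h0])

lemma locallyIntegrable_segment_integral {f : E3 → ℂ} (hm : StronglyMeasurable f)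
    (hf : LocallyIntegrable f volume) (h : E3) {t : ℝ} (ht : t ≤ 1) :
    LocallyIntegrable (fun y => ∫ r in Set.Ioc (0 : ℝ) t, f (y + r • h)) volume := by
  rw [locallyIntegrable_iff]
  intro K hK
  exact (segment_restrict hm hf h hK ht).integral_prod_left

lemma LocallyIntegrable.comp_add_right_E3 {f : E3 → ℂ} (hf : LocallyIntegrable f volume)
    (a : E3) : LocallyIntegrable (fun y => f (y + a)) volume := by
  rw [locallyIntegrable_iff]
  intro K hK
  have h1 := (locallyIntegrable_iff.1 hf) ((fun y => y + a) '' K) (hK.image (by fun_prop))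
  exact ((measurePreserving_add_right volume a).integrableOn_image
    (measurableEmbedding_addRight a)).1 h1

/-- The fundamental theorem of calculus along a fixed direction for a weak gradient. -/
lemma ae_eq_add_segment_integral {u : E3 → ℂ} {G : E3 → EuclideanSpace ℂ (Fin 3)}
    (hG : StronglyMeasurable G) (hw : HasWeakGradient u G) (h : E3) {t : ℝ}
    (ht : t ∈ Set.Icc (0 : ℝ) 1) :
    ∀ᵐ y, u (y + t • h) = u y + ∫ r in Set.Ioc (0 : ℝ) t, dirPairing h (G (y + r • h)) := by
  have hgm : StronglyMeasurable fun z => dirPairing h (G z) :=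
    (continuous_dirPairing.comp (Continuous.prodMk_right h)).comp_stronglyMeasurable hG
  have hgl := locallyIntegrable_dirPairing hw.2.1 h
  have hseg := locallyIntegrable_segment_integral hgm hgl h ht.2
  have hut := LocallyIntegrable.comp_add_right_E3 hw.1 (t • h)
  -- Tested against `φ`, the claim is the classical fundamental theorem of calculus for a `C¹`
  -- function of `t`, combined with Fubini.
  refine ae_eq_of_integral_contDiff_smul_eq hut (hw.1.add hseg) fun φ hφ hc => ?_
  have hFTC := intervalIntegral.integral_eq_sub_of_hasDerivAt (a := 0) (b := t)
    (fun r _ => hasDerivAt_integral_test_line hw hφ hc h r)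
    (Continuous.intervalIntegrable ((continuous_integral_test_translate hgl hφ.continuous hc).comp
      (continuous_id.smul continuous_const)) 0 t)
  have hI1 := hw.1.integrable_smul_left_of_hasCompactSupport hφ.continuous hc
  have hI2 := hseg.integrable_smul_left_of_hasCompactSupport hφ.continuous hc
  simp only [smul_add]
  rw [integral_add hI1 hI2]
  rw [intervalIntegral.integral_of_le ht.1,
    ← integral_integral_swap (integrable_test_segment hgm hgl h hφ.continuous hc ht.2)] at hFTC
  simp only [zero_smul, add_zero] at hFTC
  simp_rw [← integral_smul]
  rw [hFTC]
  ring

lemma ae_segment_integrable {f : E3 → ℂ} (hm : StronglyMeasurable f)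
    (hf : LocallyIntegrable f volume) (h : E3) :
    ∀ᵐ y, IntegrableOn (fun r : ℝ => f (y + r • h)) (Set.Ioc 0 1) volume := by
  have : ∀ n : ℕ, ∀ᵐ y, y ∈ Metric.closedBall (0 : E3) n →
      IntegrableOn (fun r : ℝ => f (y + r • h)) (Set.Ioc 0 1) volume := by
    intro n
    have h1 := (integrable_segment_translate hm hf h
      (isCompact_closedBall (0 : E3) n)).prod_right_ae
    exact (ae_restrict_iff' measurableSet_closedBall).1 h1
  filter_upwards [ae_all_iff.2 this] with y hy
  obtain ⟨n, hn⟩ := exists_nat_ge ‖y‖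
  exact hy n (by simpa using hn)

/-- Fubini exchanges "for each `t`, almost every `y`" with "for almost every `y`, almost every `t`".
The exceptional set must be measurable, which is why strongly measurable representatives are used.
-/
lemma ae_ae_eq_add_segment_integral {u : E3 → ℂ} {G : E3 → EuclideanSpace ℂ (Fin 3)}
    (hu : StronglyMeasurable u) (hG : StronglyMeasurable G) (hw : HasWeakGradient u G) (h : E3) :
    ∀ᵐ y, ∀ᵐ t ∂volume.restrict (Set.Ioc (0 : ℝ) 1),
      u (y + t • h) = u y + ∫ r in Set.Ioc (0 : ℝ) t, dirPairing h (G (y + r • h)) := by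
  have hgm : StronglyMeasurable fun z => dirPairing h (G z) :=
    (continuous_dirPairing.comp (Continuous.prodMk_right h)).comp_stronglyMeasurable hG
  have hmeas : StronglyMeasurable fun q : E3 × ℝ =>
      ∫ r in Set.Ioc (0 : ℝ) q.2, dirPairing h (G (q.1 + r • h)) := by
    -- Writing the variable upper limit as an indicator makes the integral a parametric one over a
    -- fixed domain, hence measurable in `q`.
    have e : ∀ q : E3 × ℝ, ∫ r in Set.Ioc (0 : ℝ) q.2, dirPairing h (G (q.1 + r • h)) =
        ∫ r, {p : (E3 × ℝ) × ℝ | 0 < p.2 ∧ p.2 ≤ p.1.2}.indicator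
          (fun p => dirPairing h (G (p.1.1 + p.2 • h))) (q, r) := by
      intro q
      rw [← integral_indicator measurableSet_Ioc]
      rfl
    simp_rw [e]
    refine StronglyMeasurable.integral_prod_right' (StronglyMeasurable.indicator ?_ ?_)
    · exact hgm.comp_measurable (by fun_prop)
    · exact (measurableSet_lt measurable_const measurable_snd).inter
        (measurableSet_le measurable_snd (by fun_prop))
  rw [Measure.ae_ae_comm]
  · filter_upwards [ae_restrict_mem measurableSet_Ioc] with t ht
    exact ae_eq_add_segment_integral hG hw h ⟨ht.1.le, ht.2⟩
  · refine measurableSet_eq_fun ?_ ?_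
    · exact hu.measurable.comp (by fun_prop)
    · exact (hu.measurable.comp measurable_fst).add hmeas.measurable

/-! ### Unimodular phases and integration by parts. -/

/-- The unimodular phase `e^{ix}`. -/
def phase (x : ℝ) : ℂ := Complex.exp (Complex.I * (x : ℂ))

lemma norm_phase (x : ℝ) : ‖phase x‖ = 1 := by
  rw [phase, mul_comm, Complex.norm_exp_ofReal_mul_I]

lemma norm_phase_sub_one_le (x : ℝ) : ‖phase x - 1‖ ≤ min 2 |x| := by
  refine le_min ?_ Real.norm_exp_I_mul_ofReal_sub_one_le
  calc ‖phase x - 1‖ ≤ ‖phase x‖ + ‖(1 : ℂ)‖ := norm_sub_le _ _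
    _ = 2 := by rw [norm_phase, norm_one]; norm_num

lemma continuous_phase : Continuous phase := by
  unfold phase
  fun_prop

lemma phase_mul_phase_neg (x : ℝ) : phase x * phase (-x) = 1 := by
  rw [phase, phase, ← Complex.exp_add]
  simp

lemma integral_phase_line (a t : ℝ) :
    ∫ r in t..1, Complex.I * a * phase (-(r * a)) = phase (-(t * a)) - phase (-a) := by
  have hd : ∀ r : ℝ, HasDerivAt (fun r : ℝ => -phase (-(r * a)))
      (Complex.I * a * phase (-(r * a))) r := by
    intro r
    have h0 : HasDerivAt (fun r : ℝ => -(r * a)) (-a) r := (hasDerivAt_mul_const a).neg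
    have h1 : HasDerivAt (fun r : ℝ => Complex.I * ((-(r * a) : ℝ) : ℂ))
        (Complex.I * ((-a : ℝ) : ℂ)) r := h0.ofReal_comp.const_mul _
    have h2 := h1.cexp.neg
    refine h2.congr_deriv ?_
    simp only [phase]
    push_cast
    ring
  rw [intervalIntegral.integral_eq_sub_of_hasDerivAt (fun r _ => hd r)]
  · simp
    ring
  · apply Continuous.intervalIntegrable
    have := continuous_phase
    fun_prop

/-- Integration by parts against a phase, for an absolutely continuous function given as a
primitive. -/
lemma phase_primitive_identity {γ : ℝ → ℂ} (hγ : IntegrableOn γ (Set.Ioc 0 1) volume)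
    (c : ℂ) (a : ℝ) :
    IntegrableOn (fun t : ℝ => phase (-(t * a)) *
      (γ t - Complex.I * a * (c + ∫ r in Set.Ioc (0 : ℝ) t, γ r))) (Set.Ioc 0 1) volume ∧
    ∫ t in Set.Ioc (0 : ℝ) 1, phase (-(t * a)) *
      (γ t - Complex.I * a * (c + ∫ r in Set.Ioc (0 : ℝ) t, γ r)) =
    phase (-a) * (c + ∫ r in Set.Ioc (0 : ℝ) 1, γ r) - c := by
  set ν : Measure ℝ := volume.restrict (Set.Ioc (0 : ℝ) 1) with hν
  have hcont : Continuous fun t : ℝ => phase (-(t * a)) := by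
    have := continuous_phase
    fun_prop
  set E : ℝ → ℂ := fun t => phase (-(t * a)) with hE
  have hEI : Integrable (fun t => Complex.I * a * E t) ν :=
    ((continuous_const.mul hcont).integrableOn_Icc (a := 0) (b := 1)).mono_set
      Set.Ioc_subset_Icc_self
  have hEγ : Integrable (fun t => E t * γ t) ν := by
    refine hγ.bdd_mul (c := 1) hcont.aestronglyMeasurable (Eventually.of_forall fun t => ?_)
    exact (norm_phase _).le
  set T : Set (ℝ × ℝ) := {q | q.2 ≤ q.1} with hT
  have hTm : MeasurableSet T := measurableSet_le measurable_snd measurable_fst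
  have hprod : Integrable (Function.uncurry fun t r : ℝ =>
      T.indicator (fun q => Complex.I * a * E q.1 * γ q.2) (t, r)) (ν.prod ν) :=
    (hEI.mul_prod hγ).indicator hTm
  have inner1 : ∀ t ∈ Set.Ioc (0 : ℝ) 1,
      ∫ r, T.indicator (fun q => Complex.I * a * E q.1 * γ q.2) (t, r) ∂ν =
        Complex.I * a * E t * ∫ r in Set.Ioc (0 : ℝ) t, γ r := by
    intro t ht
    have e : (fun r => T.indicator (fun q => Complex.I * a * E q.1 * γ q.2) (t, r)) =
        (Set.Iic t).indicator fun r => Complex.I * a * E t * γ r := rfl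
    rw [e, integral_indicator measurableSet_Iic, hν, Measure.restrict_restrict measurableSet_Iic,
      integral_const_mul, Set.inter_comm, Set.Ioc_inter_Iic, min_eq_right ht.2]
  have inner2 : ∀ r ∈ Set.Ioc (0 : ℝ) 1,
      ∫ t, T.indicator (fun q => Complex.I * a * E q.1 * γ q.2) (t, r) ∂ν =
        E r * γ r - phase (-a) * γ r := by
    intro r hr
    have e : (fun t => T.indicator (fun q => Complex.I * a * E q.1 * γ q.2) (t, r)) =
        (Set.Ici r).indicator fun t => Complex.I * a * E t * γ r := rfl
    have hset : Set.Ici r ∩ Set.Ioc (0 : ℝ) 1 = Set.Icc r 1 := by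
      ext t
      simp only [Set.mem_inter_iff, Set.mem_Ici, Set.mem_Ioc, Set.mem_Icc]
      exact ⟨fun h => ⟨h.1, h.2.2⟩, fun h => ⟨h.1, hr.1.trans_le h.1, h.2⟩⟩
    rw [e, integral_indicator measurableSet_Ici, hν, Measure.restrict_restrict measurableSet_Ici,
      hset, integral_Icc_eq_integral_Ioc, ← intervalIntegral.integral_of_le hr.2,
      intervalIntegral.integral_mul_const, integral_phase_line, sub_mul]
  have hI3 : Integrable (fun t => Complex.I * a * E t * ∫ r in Set.Ioc (0 : ℝ) t, γ r) ν := by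
    refine hprod.integral_prod_left.congr ?_
    filter_upwards [ae_restrict_mem measurableSet_Ioc] with t ht
    exact inner1 t ht
  have hsplit : ∀ t, phase (-(t * a)) * (γ t - Complex.I * a *
      (c + ∫ r in Set.Ioc (0 : ℝ) t, γ r)) = E t * γ t - (Complex.I * a * E t * c +
        Complex.I * a * E t * ∫ r in Set.Ioc (0 : ℝ) t, γ r) := by
    intro t
    simp only [hE]
    ring
  have hswap := integral_integral_swap hprod
  rw [setIntegral_congr_fun measurableSet_Ioc inner1,
    setIntegral_congr_fun measurableSet_Ioc inner2,
    integral_sub hEγ (hγ.const_mul _), integral_const_mul] at hswap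
  have hE1 : ∫ t, Complex.I * a * E t ∂ν = 1 - phase (-a) := by
    rw [hν, ← intervalIntegral.integral_of_le zero_le_one, integral_phase_line]
    simp [phase]
  simp_rw [hsplit]
  have hI4 : Integrable (fun t => Complex.I * a * E t * c +
      Complex.I * a * E t * ∫ r in Set.Ioc (0 : ℝ) t, γ r) ν := (hEI.mul_const c).add hI3
  refine ⟨hEγ.sub hI4, ?_⟩
  rw [integral_sub hEγ hI4, integral_add (hEI.mul_const c) hI3, hswap,
    integral_mul_const, hE1]
  ring

/-! ### First-order expansion along a segment with frozen phase. -/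

/-- The magnetic phase exponent `⟨h, A(y + h/2)⟩`, written as in the difference quotient. -/
def midpointPhase (A : E3 → E3) (h y : E3) : ℝ :=
  inner ℝ h (A ((1 / 2 : ℝ) • (y + h + y)))

lemma norm_midpoint_sub_le (h y : E3) {t : ℝ} (ht : t ∈ Set.Icc (0 : ℝ) 1) :
    ‖y + t • h - (1 / 2 : ℝ) • (y + h + y)‖ ≤ ‖h‖ := by
  have : y + t • h - (1 / 2 : ℝ) • (y + h + y) = (t - 1 / 2) • h := by module
  rw [this, norm_smul, Real.norm_eq_abs]
  have : |t - 1 / 2| ≤ 1 := abs_le.2 ⟨by linarith [ht.1], by linarith [ht.2]⟩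
  exact mul_le_of_le_one_left (norm_nonneg _) this

lemma abs_inner_sub_midpointPhase_le {A : E3 → E3} {L : NNReal} (hA : LipschitzWith L A)
    (h y : E3) {t : ℝ} (ht : t ∈ Set.Icc (0 : ℝ) 1) :
    |inner ℝ h (A (y + t • h)) - midpointPhase A h y| ≤ ‖h‖ * (L * ‖h‖) := by
  rw [midpointPhase, ← inner_sub_right]
  refine (abs_real_inner_le_norm _ _).trans ?_
  gcongr
  refine (hA.norm_sub_le _ _).trans ?_
  gcongr
  exact norm_midpoint_sub_le h y ht

lemma abs_midpointPhase_le {A : E3 → E3} {L : NNReal} (hA : LipschitzWith L A) (h y : E3) :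
    |midpointPhase A h y| ≤ ‖h‖ * (‖A y‖ + L * ‖h‖) := by
  have h1 := abs_inner_sub_midpointPhase_le hA h y (t := 0) (by simp)
  have h2 := abs_real_inner_le_norm h (A y)
  simp only [zero_smul, add_zero] at h1
  calc |midpointPhase A h y|
      = |inner ℝ h (A y) - (inner ℝ h (A y) - midpointPhase A h y)| := by rw [sub_sub_cancel]
    _ ≤ |inner ℝ h (A y)| + |inner ℝ h (A y) - midpointPhase A h y| := abs_sub _ _
    _ ≤ ‖h‖ * (‖A y‖ + L * ‖h‖) := by linarith

lemma dirPairing_covariantGradient (A : E3 → E3) (u : E3 → ℂ)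
    (G : E3 → EuclideanSpace ℂ (Fin 3)) (h x : E3) :
    dirPairing h (covariantGradient A u G x) =
      dirPairing h (G x) - Complex.I * (inner ℝ h (A x) : ℝ) * u x := by
  simp [dirPairing, covariantGradient, PiLp.inner_apply, Fin.sum_univ_three]
  ring

/-- Replacing `a` by the true value `h · A(y + th)` turns the bracket into `h · D(y + th)`. The
three terms on the right are the translation of `D`, the phase acting on `D y`, and the error of
that replacement. The cap 2 keeps the second one dominated where `A` is large. -/
lemma covariant_segment_pointwise {A : E3 → E3} {L : NNReal} (hA : LipschitzWith L A)
    (u : E3 → ℂ) (G : E3 → EuclideanSpace ℂ (Fin 3)) (h y : E3) {t : ℝ}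
    (ht : t ∈ Set.Icc (0 : ℝ) 1) :
    ‖phase (-(t * midpointPhase A h y)) * (dirPairing h (G (y + t • h)) -
        Complex.I * midpointPhase A h y * u (y + t • h)) -
      dirPairing h (covariantGradient A u G y)‖ ≤
    ‖h‖ * (‖covariantGradient A u G (y + t • h) - covariantGradient A u G y‖ +
      min 2 (‖h‖ * (‖A y‖ + L * ‖h‖)) * ‖covariantGradient A u G y‖ +
      L * ‖h‖ * ‖u (y + t • h)‖) := by
  set a := midpointPhase A h y with ha
  set D := covariantGradient A u G with hD
  have hsplit : phase (-(t * a)) * (dirPairing h (G (y + t • h)) - Complex.I * a * u (y + t • h)) -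
      dirPairing h (D y) = phase (-(t * a)) * dirPairing h (D (y + t • h) - D y) +
        (phase (-(t * a)) - 1) * dirPairing h (D y) +
        phase (-(t * a)) * (Complex.I * ((inner ℝ h (A (y + t • h)) - a : ℝ) : ℂ) *
          u (y + t • h)) := by
    rw [dirPairing_sub, hD, dirPairing_covariantGradient A u G h (y + t • h)]
    push_cast
    ring
  rw [hsplit]
  have hta : |-(t * a)| ≤ ‖h‖ * (‖A y‖ + L * ‖h‖) := by
    rw [abs_neg, abs_mul, abs_of_nonneg ht.1]
    exact (mul_le_of_le_one_left (abs_nonneg _) ht.2).trans (abs_midpointPhase_le hA h y)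
  have b1 : ‖phase (-(t * a)) * dirPairing h (D (y + t • h) - D y)‖ ≤
      ‖h‖ * ‖D (y + t • h) - D y‖ := by
    rw [norm_mul, norm_phase, one_mul]
    exact norm_dirPairing_le _ _
  have b2 : ‖(phase (-(t * a)) - 1) * dirPairing h (D y)‖ ≤
      min 2 (‖h‖ * (‖A y‖ + L * ‖h‖)) * (‖h‖ * ‖D y‖) := by
    rw [norm_mul]
    exact mul_le_mul ((norm_phase_sub_one_le _).trans (min_le_min le_rfl hta))
      (norm_dirPairing_le _ _) (norm_nonneg _) (by positivity)
  have b3 : ‖phase (-(t * a)) * (Complex.I * ((inner ℝ h (A (y + t • h)) - a : ℝ) : ℂ) *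
      u (y + t • h))‖ ≤ ‖h‖ * (L * ‖h‖) * ‖u (y + t • h)‖ := by
    rw [norm_mul, norm_phase, one_mul, norm_mul, norm_mul, Complex.norm_I, one_mul,
      Complex.norm_real, Real.norm_eq_abs]
    gcongr
    exact abs_inner_sub_midpointPhase_le hA h y ht
  refine (norm_add₃_le).trans ((add_le_add (add_le_add b1 b2) b3).trans (le_of_eq ?_))
  ring

/-- Cauchy–Schwarz against the constant 1. -/
lemma lintegral_sq_le_of_isProbabilityMeasure {α : Type*} [MeasurableSpace α] (μ : Measure α)
    [IsProbabilityMeasure μ] {f : α → ENNReal} (hf : AEMeasurable f μ) :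
    (∫⁻ x, f x ∂μ) ^ 2 ≤ ∫⁻ x, f x ^ 2 ∂μ := by
  have h := ENNReal.lintegral_mul_le_Lp_mul_Lq μ Real.HolderConjugate.two_two hf
    (aemeasurable_const (b := 1))
  simp only [Pi.mul_apply, lintegral_const, measure_univ, mul_one,
    ENNReal.rpow_two, one_pow, ENNReal.one_rpow] at h
  calc (∫⁻ x, f x ∂μ) ^ 2 ≤ ((∫⁻ x, f x ^ 2 ∂μ) ^ (1 / 2 : ℝ)) ^ 2 := by gcongr
    _ = ∫⁻ x, f x ^ 2 ∂μ := by
      rw [← ENNReal.rpow_two, ← ENNReal.rpow_mul]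
      norm_num

lemma add_sq_three_le (x y z : ℝ) : (x + y + z) ^ 2 ≤ 3 * (x ^ 2 + y ^ 2 + z ^ 2) := by
  nlinarith [sq_nonneg (x - y), sq_nonneg (y - z), sq_nonneg (x - z)]

/-- The remainder is the average over the segment of the pointwise error, so Jensen moves the square
inside; the factor 3 comes from squaring a sum of three terms. -/
lemma ae_enorm_remainder_sq_le {A : E3 → E3} {L : NNReal} (hA : LipschitzWith L A)
    {u : E3 → ℂ} {G : E3 → EuclideanSpace ℂ (Fin 3)}
    (hu : StronglyMeasurable u) (hG : StronglyMeasurable G) (hw : HasWeakGradient u G) (h : E3) :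
    ∀ᵐ y, ‖phase (-midpointPhase A h y) * u (y + h) - u y -
        dirPairing h (covariantGradient A u G y)‖ₑ ^ 2 ≤
      ∫⁻ t in Set.Ioc (0 : ℝ) 1, ENNReal.ofReal (3 * ‖h‖ ^ 2) *
        (‖covariantGradient A u G (y + t • h) - covariantGradient A u G y‖ₑ ^ 2 +
          ENNReal.ofReal (min 2 (‖h‖ * (‖A y‖ + L * ‖h‖)) ^ 2) *
            ‖covariantGradient A u G y‖ₑ ^ 2 +
          ENNReal.ofReal ((L * ‖h‖) ^ 2) * ‖u (y + t • h)‖ₑ ^ 2) := by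
  have hgm : StronglyMeasurable fun z => dirPairing h (G z) :=
    (continuous_dirPairing.comp (Continuous.prodMk_right h)).comp_stronglyMeasurable hG
  filter_upwards [ae_segment_integrable hgm (locallyIntegrable_dirPairing hw.2.1 h) h,
    ae_ae_eq_add_segment_integral hu hG hw h,
    ae_eq_add_segment_integral hG hw h (t := 1) (by simp)] with y hI hline hend
  rw [one_smul] at hend
  obtain ⟨hI1, hE⟩ := phase_primitive_identity hI (u y) (midpointPhase A h y)
  rw [← hend] at hE
  set a := midpointPhase A h y with ha
  set D := covariantGradient A u G with hD
  set ν : Measure ℝ := volume.restrict (Set.Ioc (0 : ℝ) 1) with hν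
  -- Total mass 1 lets the constant `dirPairing h (D y)` be brought under the integral.
  have : IsProbabilityMeasure ν := ⟨by simp [hν]⟩
  have hX : ∫ t, (phase (-(t * a)) * (dirPairing h (G (y + t • h)) - Complex.I * a *
      (u y + ∫ r in Set.Ioc (0 : ℝ) t, dirPairing h (G (y + r • h)))) -
      dirPairing h (D y)) ∂ν = phase (-a) * u (y + h) - u y - dirPairing h (D y) := by
    rw [integral_sub hI1 (integrable_const _), hE]
    simp
  rw [← hX]
  have hXI := hI1.sub (integrable_const (μ := ν) (dirPairing h (D y)))
  refine (pow_le_pow_left₀ (zero_le) (enorm_integral_le_lintegral_enorm _) 2).trans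
    ((lintegral_sq_le_of_isProbabilityMeasure ν hXI.1.enorm).trans (lintegral_mono_ae ?_))
  filter_upwards [hline, ae_restrict_mem measurableSet_Ioc] with t ht htm
  simp only [Pi.sub_apply]
  -- For almost every `t` the primitive equals `u (y + t • h)`.
  rw [← ht]
  have hb := covariant_segment_pointwise hA u G h y (t := t) ⟨htm.1.le, htm.2⟩
  simp only [← ofReal_norm]
  have hpow : ∀ z : ℝ, 0 ≤ z → ENNReal.ofReal z ^ 2 = ENNReal.ofReal (z ^ 2) :=
    fun z hz => (ENNReal.ofReal_pow hz 2).symm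
  rw [hpow _ (norm_nonneg _), hpow _ (norm_nonneg _), hpow _ (norm_nonneg _),
    hpow _ (norm_nonneg _), ← ENNReal.ofReal_mul (by positivity),
    ← ENNReal.ofReal_mul (by positivity), ← ENNReal.ofReal_add (by positivity) (by positivity),
    ← ENNReal.ofReal_add (by positivity) (by positivity), ← ENNReal.ofReal_mul (by positivity)]
  refine ENNReal.ofReal_le_ofReal ((pow_le_pow_left₀ (norm_nonneg _) hb 2).trans ?_)
  rw [mul_pow]
  refine (mul_le_mul_of_nonneg_left (add_sq_three_le _ _ _) (by positivity)).trans
    (le_of_eq ?_)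
  ring

/-! ### Smallness of the remainder in `L²`. -/

lemma lintegral_enorm_sq_ne_top {F : Type*} [NormedAddCommGroup F] {f : E3 → F}
    (hf : MemLp f 2 volume) : ∫⁻ y, ‖f y‖ₑ ^ 2 ≠ ⊤ := by
  have h := eLpNorm_nnreal_pow_eq_lintegral (μ := volume) (f := f) (p := 2) two_ne_zero
  simp only [NNReal.coe_ofNat, ENNReal.rpow_ofNat, ENNReal.coe_ofNat] at h
  rw [← h]
  exact ENNReal.pow_ne_top hf.2.ne

/-- Translations act continuously on `L²`; `DomAddAct` expresses this action. -/
lemma tendsto_lintegral_translate_sub {D : E3 → EuclideanSpace ℂ (Fin 3)}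
    (hD : MemLp D 2 volume) :
    Tendsto (fun k : E3 => ∫⁻ y, ‖D (y + k) - D y‖ₑ ^ 2) (𝓝 0) (𝓝 0) := by
  have : Fact ((2 : ENNReal) ≠ ⊤) := ⟨by simp⟩
  set f := hD.toLp with hf
  have hcont : Continuous fun k : E3 => DomAddAct.mk k +ᵥ f :=
    DomAddAct.continuous_mk.vadd continuous_const
  have h1 : Tendsto (fun k : E3 => edist (DomAddAct.mk k +ᵥ f) f ^ 2) (𝓝 0) (𝓝 0) := by
    have h2 := (ENNReal.continuous_pow 2).comp (hcont.edist (continuous_const (y := f)))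
    have h3 := h2.tendsto 0
    simpa [DomAddAct.mk_zero, Function.comp_def] using h3
  refine h1.congr fun k => ?_
  rw [hf, DomAddAct.mk_vadd_toLp, Lp.edist_toLp_toLp]
  have h4 := eLpNorm_nnreal_pow_eq_lintegral (μ := volume)
    (f := (fun x => D (k +ᵥ x)) - D) (p := 2) two_ne_zero
  simp only [NNReal.coe_ofNat, ENNReal.rpow_ofNat, ENNReal.coe_ofNat] at h4
  rw [h4]
  simp [add_comm]

/-- The weight tends to 0 pointwise but not uniformly, `A` being possibly unbounded; dominated
convergence applies with majorant `4‖D‖²`. -/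
lemma tendsto_lintegral_weight {A : E3 → E3} {L : NNReal} (hA : LipschitzWith L A)
    {D : E3 → EuclideanSpace ℂ (Fin 3)} (hDm : StronglyMeasurable D) (hD : MemLp D 2 volume) :
    Tendsto (fun h : E3 => ∫⁻ y, ENNReal.ofReal (min 2 (‖h‖ * (‖A y‖ + L * ‖h‖)) ^ 2) *
      ‖D y‖ₑ ^ 2) (𝓝 0) (𝓝 0) := by
  have hAm : Measurable A := hA.continuous.measurable
  have hDm' := hDm.measurable
  have hfin : ∫⁻ y, ENNReal.ofReal (2 ^ 2) * ‖D y‖ₑ ^ 2 ≠ ⊤ := by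
    rw [lintegral_const_mul _ (by fun_prop)]
    exact ENNReal.mul_ne_top ENNReal.ofReal_ne_top (lintegral_enorm_sq_ne_top hD)
  have h := tendsto_lintegral_filter_of_dominated_convergence (μ := volume) (l := 𝓝 (0 : E3))
    (F := fun h y => ENNReal.ofReal (min 2 (‖h‖ * (‖A y‖ + L * ‖h‖)) ^ 2) * ‖D y‖ₑ ^ 2)
    (f := fun _ => 0) (fun y => ENNReal.ofReal (2 ^ 2) * ‖D y‖ₑ ^ 2)
    (Eventually.of_forall fun h => by fun_prop)
    (Eventually.of_forall fun h => Eventually.of_forall fun y => by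
      gcongr
      exact min_le_left _ _) hfin
    (Eventually.of_forall fun y => by
      have hc : Continuous fun h : E3 =>
          ENNReal.ofReal (min 2 (‖h‖ * (‖A y‖ + L * ‖h‖)) ^ 2) :=
        ENNReal.continuous_ofReal.comp (by fun_prop)
      have h1 := hc.tendsto 0
      simp only [norm_zero, zero_mul, min_eq_right zero_le_two, ne_eq, OfNat.ofNat_ne_zero,
        not_false_eq_true, zero_pow, ENNReal.ofReal_zero] at h1
      have h2 := ENNReal.Tendsto.mul_const (b := ‖D y‖ₑ ^ 2) h1
        (Or.inr (ENNReal.pow_ne_top enorm_ne_top))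
      simpa using h2)
  simpa using h

/-- First-order expansion of the covariant difference in `L²`, uniform in the direction. -/
lemma lintegral_remainder_le {A : E3 → E3} {L : NNReal} (hA : LipschitzWith L A)
    {u : E3 → ℂ} {G : E3 → EuclideanSpace ℂ (Fin 3)}
    (hu : StronglyMeasurable u) (hG : StronglyMeasurable G) (hw : HasWeakGradient u G)
    (hu2 : MemLp u 2 volume) (hD : MemLp (covariantGradient A u G) 2 volume)
    (hDm : StronglyMeasurable (covariantGradient A u G)) {ε : ℝ} (hε : 0 < ε) :
    ∃ δ > 0, ∀ h : E3, ‖h‖ < δ →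
      ∫⁻ y, ‖phase (-midpointPhase A h y) * u (y + h) - u y -
        dirPairing h (covariantGradient A u G y)‖ₑ ^ 2 ≤ ENNReal.ofReal (ε * ‖h‖ ^ 2) := by
  set D := covariantGradient A u G with hDdef
  -- Three error terms and the prefactor 3 account for the 9.
  have hε' : 0 < ENNReal.ofReal (ε / 9) := ENNReal.ofReal_pos.2 (by positivity)
  have t1 := ENNReal.tendsto_nhds_zero.1 (tendsto_lintegral_translate_sub hD) _ hε'
  have t2 := ENNReal.tendsto_nhds_zero.1 (tendsto_lintegral_weight hA hDm hD) _ hε'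
  have t3' : Tendsto (fun h : E3 => ENNReal.ofReal ((L * ‖h‖) ^ 2) * ∫⁻ y, ‖u y‖ₑ ^ 2)
      (𝓝 0) (𝓝 0) := by
    have hc : Continuous fun h : E3 => ENNReal.ofReal ((L * ‖h‖) ^ 2) :=
      ENNReal.continuous_ofReal.comp (by fun_prop)
    have h1 := ENNReal.Tendsto.mul_const (b := ∫⁻ y, ‖u y‖ₑ ^ 2) (hc.tendsto 0)
      (Or.inr (lintegral_enorm_sq_ne_top hu2))
    simpa using h1
  have t3 := ENNReal.tendsto_nhds_zero.1 t3' _ hε'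
  obtain ⟨δ, hδ, hball⟩ := Metric.eventually_nhds_iff.1 (t1.and (t2.and t3))
  simp only [dist_zero_right] at hball
  refine ⟨δ, hδ, fun h hh => ?_⟩
  have hAm : Measurable A := hA.continuous.measurable
  have hum := hu.measurable
  have hDm' := hDm.measurable
  refine (lintegral_mono_ae (ae_enorm_remainder_sq_le hA hu hG hw h)).trans ?_
  simp only [← hDdef]
  -- Integrating in `y` first gives a bound uniform in `t`, since `‖t • h‖ ≤ ‖h‖` and the norm of
  -- `u` is translation invariant.
  rw [lintegral_lintegral_swap (by
    apply Measurable.aemeasurable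
    unfold Function.uncurry
    fun_prop)]
  have hinner : ∀ t ∈ Set.Ioc (0 : ℝ) 1, ∫⁻ y, ENNReal.ofReal (3 * ‖h‖ ^ 2) *
      (‖D (y + t • h) - D y‖ₑ ^ 2 +
        ENNReal.ofReal (min 2 (‖h‖ * (‖A y‖ + L * ‖h‖)) ^ 2) * ‖D y‖ₑ ^ 2 +
        ENNReal.ofReal ((L * ‖h‖) ^ 2) * ‖u (y + t • h)‖ₑ ^ 2) ≤
      ENNReal.ofReal (ε * ‖h‖ ^ 2) := by
    intro t ht
    rw [lintegral_const_mul _ (by fun_prop), lintegral_add_left (by fun_prop),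
      lintegral_add_left (by fun_prop), lintegral_const_mul _ (by fun_prop),
      lintegral_add_right_eq_self (fun y => ‖u y‖ₑ ^ 2) (t • h)]
    have hth : ‖t • h‖ < δ := by
      rw [norm_smul, Real.norm_of_nonneg ht.1.le]
      exact (mul_le_of_le_one_left (norm_nonneg _) ht.2).trans_lt hh
    calc _ ≤ ENNReal.ofReal (3 * ‖h‖ ^ 2) * (ENNReal.ofReal (ε / 9) + ENNReal.ofReal (ε / 9) +
          ENNReal.ofReal (ε / 9)) := by
          gcongr
          · exact (hball hth).1
          · exact (hball hh).2.1
          · exact (hball hh).2.2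
      _ = ENNReal.ofReal (ε * ‖h‖ ^ 2) := by
          rw [← ENNReal.ofReal_add (by positivity) (by positivity),
            ← ENNReal.ofReal_add (by positivity) (by positivity),
            ← ENNReal.ofReal_mul (by positivity)]
          congr 1
          ring
  calc _ ≤ ∫⁻ t in Set.Ioc (0 : ℝ) 1, ENNReal.ofReal (ε * ‖h‖ ^ 2) := by
        refine lintegral_mono_ae ?_
        filter_upwards [ae_restrict_mem measurableSet_Ioc] with t ht
        exact hinner t ht
    _ = ENNReal.ofReal (ε * ‖h‖ ^ 2) := by simp

/-! ### Comparison of the two energies. -/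

/-- The gauge-transformed covariant difference. -/
def covariantDiff (A : E3 → E3) (u : E3 → ℂ) (h y : E3) : ℂ :=
  phase (-midpointPhase A h y) * u (y + h) - u y

lemma measurable_covariantDiff {A : E3 → E3} (hA : Continuous A) {u : E3 → ℂ}
    (hu : StronglyMeasurable u) :
    Measurable fun q : E3 × E3 => covariantDiff A u q.1 q.2 := by
  have hum := hu.measurable
  have hp : Continuous fun q : E3 × E3 => phase (-midpointPhase A q.1 q.2) := by
    have := continuous_phase
    unfold midpointPhase
    fun_prop
  unfold covariantDiff
  exact (hp.measurable.mul (by fun_prop)).sub (by fun_prop)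

lemma memLp_translate {u : E3 → ℂ} (hu2 : MemLp u 2 volume) (h : E3) :
    MemLp (fun y => u (y + h)) 2 volume :=
  hu2.comp_measurePreserving (measurePreserving_add_right volume h)

lemma norm_covariantDiff_le (A : E3 → E3) (u : E3 → ℂ) (h y : E3) :
    ‖covariantDiff A u h y‖ ≤ ‖u (y + h)‖ + ‖u y‖ := by
  refine (norm_sub_le _ _).trans ?_
  rw [norm_mul, norm_phase, one_mul]

lemma memLp_covariantDiff {A : E3 → E3} (hA : Continuous A) {u : E3 → ℂ}
    (hu : StronglyMeasurable u) (hu2 : MemLp u 2 volume) (h : E3) :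
    MemLp (covariantDiff A u h) 2 volume := by
  have hm : Measurable (covariantDiff A u h) :=
    (measurable_covariantDiff hA hu).of_uncurry_left
  have hsum := (memLp_translate hu2 h).norm.add hu2.norm
  refine hsum.mono hm.aestronglyMeasurable (Eventually.of_forall fun y => ?_)
  rw [Pi.add_apply]
  rw [Real.norm_of_nonneg (by positivity)]
  exact norm_covariantDiff_le A u h y

lemma integral_covariantDiff_sq_le {A : E3 → E3} (hA : Continuous A) {u : E3 → ℂ}
    (hu : StronglyMeasurable u) (hu2 : MemLp u 2 volume) (h : E3) :
    ∫ y, ‖covariantDiff A u h y‖ ^ 2 ≤ 4 * ∫ y, ‖u y‖ ^ 2 := by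
  have h1 := (memLp_translate hu2 h).integrable_norm_pow two_ne_zero
  have h2 := hu2.integrable_norm_pow two_ne_zero
  have h3 : ∫ y, ‖u (y + h)‖ ^ 2 = ∫ y, ‖u y‖ ^ 2 :=
    integral_add_right_eq_self (fun y => ‖u y‖ ^ 2) h
  calc ∫ y, ‖covariantDiff A u h y‖ ^ 2
      ≤ ∫ y, (2 * ‖u (y + h)‖ ^ 2 + 2 * ‖u y‖ ^ 2) := by
        refine integral_mono ((memLp_covariantDiff hA hu hu2 h).integrable_norm_pow two_ne_zero)
          ((h1.const_mul 2).add (h2.const_mul 2)) fun y => ?_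
        refine (pow_le_pow_left₀ (norm_nonneg _) (norm_covariantDiff_le A u h y) 2).trans ?_
        nlinarith [sq_nonneg (‖u (y + h)‖ - ‖u y‖)]
    _ = 4 * ∫ y, ‖u y‖ ^ 2 := by
        rw [integral_add (h1.const_mul 2) (h2.const_mul 2), integral_const_mul,
          integral_const_mul, h3]
        ring

/-- Factor the difference of squares and split the cross term by Young's inequality with weight `η`.
-/
lemma abs_norm_sq_sub_norm_sq_le {E : Type*} [SeminormedAddCommGroup E] (p q : E) {η : ℝ}
    (hη : 0 < η) :
    |‖p‖ ^ 2 - ‖q‖ ^ 2| ≤ (1 + 1 / η) * ‖p - q‖ ^ 2 + η * ‖q‖ ^ 2 := by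
  have h1 : |‖p‖ - ‖q‖| ≤ ‖p - q‖ := abs_norm_sub_norm_le p q
  have h2 : ‖p‖ + ‖q‖ ≤ ‖p - q‖ + 2 * ‖q‖ := by
    have := norm_le_norm_add_norm_sub' p q
    linarith [le_abs_self (‖p‖ - ‖q‖)]
  have h3 : 2 * ‖p - q‖ * ‖q‖ ≤ 1 / η * ‖p - q‖ ^ 2 + η * ‖q‖ ^ 2 := by
    have h4 : 1 / η * ‖p - q‖ ^ 2 + η * ‖q‖ ^ 2 - 2 * ‖p - q‖ * ‖q‖ =
        (‖p - q‖ - η * ‖q‖) ^ 2 / η := by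
      field_simp
      ring
    have : 0 ≤ (‖p - q‖ - η * ‖q‖) ^ 2 / η := by positivity
    linarith
  calc |‖p‖ ^ 2 - ‖q‖ ^ 2| = |‖p‖ - ‖q‖| * (‖p‖ + ‖q‖) := by
        rw [show ‖p‖ ^ 2 - ‖q‖ ^ 2 = (‖p‖ - ‖q‖) * (‖p‖ + ‖q‖) by ring, abs_mul,
          abs_of_nonneg (a := ‖p‖ + ‖q‖) (by positivity)]
    _ ≤ ‖p - q‖ * (‖p - q‖ + 2 * ‖q‖) := by gcongr
    _ ≤ _ := by nlinarith

lemma abs_energy_sub_le_near {A : E3 → E3} {L : NNReal} (hA : LipschitzWith L A)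
    {u : E3 → ℂ} {G : E3 → EuclideanSpace ℂ (Fin 3)}
    (hu : StronglyMeasurable u) (hG : StronglyMeasurable G) (hw : HasWeakGradient u G)
    (hu2 : MemLp u 2 volume) (hD : MemLp (covariantGradient A u G) 2 volume)
    (hDm : StronglyMeasurable (covariantGradient A u G)) {ε : ℝ} (hε : 0 < ε) :
    ∃ δ > 0, ∀ h : E3, ‖h‖ < δ → |(∫ y, ‖covariantDiff A u h y‖ ^ 2) -
      ∫ y, ‖dirPairing h (covariantGradient A u G y)‖ ^ 2| ≤ ε * ‖h‖ ^ 2 := by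
  set D := covariantGradient A u G with hDdef
  set E₀ : ℝ := ∫ y, ‖D y‖ ^ 2 with hE₀
  have hE0 : 0 ≤ E₀ := integral_nonneg fun y => by positivity
  -- The choices give `η E₀ ≤ ε/2` and `(1 + 1/η) ε₁ = ε/2`; the `+ 1` covers `E₀ = 0`.
  set η : ℝ := ε / (2 * (E₀ + 1)) with hη
  have hηpos : 0 < η := by positivity
  have hηE : η * E₀ ≤ ε / 2 := by
    rw [hη, div_mul_eq_mul_div, div_le_div_iff₀ (by positivity) two_pos]
    nlinarith
  set ε₁ : ℝ := ε / (2 * (1 + 1 / η)) with hε₁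
  have hε₁pos : 0 < ε₁ := by positivity
  obtain ⟨δ, hδ, hsmall⟩ := lintegral_remainder_le hA hu hG hw hu2 hD hDm hε₁pos
  refine ⟨δ, hδ, fun h hlt => ?_⟩
  have hP := memLp_covariantDiff hA.continuous hu hu2 h
  have hPI := hP.integrable_norm_pow two_ne_zero
  have hQI := integrable_dirPairing_sq hD h
  have hQle := integral_dirPairing_sq_le hD h
  have hdm : MemLp (fun y => dirPairing h (D y)) 2 volume := by
    refine (memLp_two_iff_integrable_sq_norm ?_).2 hQI
    exact (continuous_dirPairing.comp (Continuous.prodMk_right h)).comp_aestronglyMeasurable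
      hD.1
  have hRI : Integrable (fun y => ‖covariantDiff A u h y - dirPairing h (D y)‖ ^ 2) volume :=
    (hP.sub hdm).integrable_norm_pow two_ne_zero
  have hR : ∫ y, ‖covariantDiff A u h y - dirPairing h (D y)‖ ^ 2 ≤ ε₁ * ‖h‖ ^ 2 := by
    rw [integral_eq_lintegral_of_nonneg_ae (Eventually.of_forall fun y => by positivity)
      hRI.1]
    refine ENNReal.toReal_le_of_le_ofReal (by positivity) (le_trans (le_of_eq ?_) (hsmall h hlt))
    refine lintegral_congr fun y => ?_
    rw [ENNReal.ofReal_pow (norm_nonneg _), ofReal_norm]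
    rfl
  rw [← integral_sub hPI hQI]
  calc |∫ y, (‖covariantDiff A u h y‖ ^ 2 - ‖dirPairing h (D y)‖ ^ 2)|
      ≤ ∫ y, |‖covariantDiff A u h y‖ ^ 2 - ‖dirPairing h (D y)‖ ^ 2| :=
        abs_integral_le_integral_abs
    _ ≤ ∫ y, ((1 + 1 / η) * ‖covariantDiff A u h y - dirPairing h (D y)‖ ^ 2 +
          η * ‖dirPairing h (D y)‖ ^ 2) :=
        integral_mono (hPI.sub hQI).abs ((hRI.const_mul _).add (hQI.const_mul _))
          fun y => abs_norm_sq_sub_norm_sq_le _ _ hηpos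
    _ = (1 + 1 / η) * (∫ y, ‖covariantDiff A u h y - dirPairing h (D y)‖ ^ 2) +
          η * ∫ y, ‖dirPairing h (D y)‖ ^ 2 := by
        rw [integral_add (hRI.const_mul _) (hQI.const_mul _), integral_const_mul,
          integral_const_mul]
    _ ≤ (1 + 1 / η) * (ε₁ * ‖h‖ ^ 2) + η * (‖h‖ ^ 2 * E₀) := by gcongr
    _ = (ε / 2 + η * E₀) * ‖h‖ ^ 2 := by
        rw [hε₁]
        field_simp
    _ ≤ ε * ‖h‖ ^ 2 := by
        gcongr
        linarith

/-- Both energies grow at most quadratically, so powers of `‖h‖ / δ ≥ 1` may be inserted up to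
degree 4, the degree whose normalized moment vanishes in the limit. -/
lemma abs_energy_sub_le_far {A : E3 → E3} (hA : Continuous A) {u : E3 → ℂ}
    (hu : StronglyMeasurable u) (hu2 : MemLp u 2 volume)
    {D : E3 → EuclideanSpace ℂ (Fin 3)} (hD : MemLp D 2 volume) {δ : ℝ} (hδ : 0 < δ) {h : E3}
    (hge : δ ≤ ‖h‖) :
    |(∫ y, ‖covariantDiff A u h y‖ ^ 2) - ∫ y, ‖dirPairing h (D y)‖ ^ 2| ≤
      (4 * (∫ y, ‖u y‖ ^ 2) / δ ^ 4 + (∫ y, ‖D y‖ ^ 2) / δ ^ 2) * ‖h‖ ^ 4 := by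
  have hQle := integral_dirPairing_sq_le hD h
  have hPle := integral_covariantDiff_sq_le hA hu hu2 h
  set E₀ : ℝ := ∫ y, ‖D y‖ ^ 2 with hE₀
  set U₀ : ℝ := ∫ y, ‖u y‖ ^ 2 with hU₀
  have hE0 : 0 ≤ E₀ := integral_nonneg fun y => by positivity
  have hU0 : 0 ≤ U₀ := integral_nonneg fun y => by positivity
  have hP0 : 0 ≤ ∫ y, ‖covariantDiff A u h y‖ ^ 2 := integral_nonneg fun y => by positivity
  have hQ0 : 0 ≤ ∫ y, ‖dirPairing h (D y)‖ ^ 2 := integral_nonneg fun y => by positivity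
  clear_value E₀ U₀
  have h4 : 4 * U₀ ≤ 4 * U₀ / δ ^ 4 * ‖h‖ ^ 4 := by
    rw [div_mul_eq_mul_div, le_div_iff₀ (by positivity)]
    gcongr
  have h2 : ‖h‖ ^ 2 * E₀ ≤ E₀ / δ ^ 2 * ‖h‖ ^ 4 := by
    rw [div_mul_eq_mul_div, le_div_iff₀ (by positivity)]
    calc ‖h‖ ^ 2 * E₀ * δ ^ 2 ≤ ‖h‖ ^ 2 * E₀ * ‖h‖ ^ 2 := by gcongr
      _ = E₀ * ‖h‖ ^ 4 := by ring
  rw [abs_le, add_mul]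
  constructor <;> linarith

/-- The covariant difference has the energy of the covariant directional derivative, up to
`o(|h|²)` near the origin and `O(|h|⁴)` away from it. -/
lemma abs_energy_sub_le {A : E3 → E3} {L : NNReal} (hA : LipschitzWith L A)
    {u : E3 → ℂ} {G : E3 → EuclideanSpace ℂ (Fin 3)}
    (hu : StronglyMeasurable u) (hG : StronglyMeasurable G) (hw : HasWeakGradient u G)
    (hu2 : MemLp u 2 volume) (hD : MemLp (covariantGradient A u G) 2 volume)
    (hDm : StronglyMeasurable (covariantGradient A u G)) {ε : ℝ} (hε : 0 < ε) :
    ∃ C ≥ 0, ∀ h : E3, |(∫ y, ‖covariantDiff A u h y‖ ^ 2) -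
      ∫ y, ‖dirPairing h (covariantGradient A u G y)‖ ^ 2| ≤ ε * ‖h‖ ^ 2 + C * ‖h‖ ^ 4 := by
  obtain ⟨δ, hδ, hnear⟩ := abs_energy_sub_le_near hA hu hG hw hu2 hD hDm hε
  have hC : 0 ≤ 4 * (∫ y, ‖u y‖ ^ 2) / δ ^ 4 +
      (∫ y, ‖covariantGradient A u G y‖ ^ 2) / δ ^ 2 := by
    have h1 : 0 ≤ ∫ y, ‖u y‖ ^ 2 := integral_nonneg fun y => by positivity
    have h2 : 0 ≤ ∫ y, ‖covariantGradient A u G y‖ ^ 2 := integral_nonneg fun y => by positivity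
    positivity
  refine ⟨_, hC, fun h => ?_⟩
  rcases lt_or_ge ‖h‖ δ with hlt | hge
  · exact (hnear h hlt).trans (le_add_of_nonneg_right (by positivity))
  · exact (abs_energy_sub_le_far hA.continuous hu hu2 hD hδ hge).trans
      (le_add_of_nonneg_left (by positivity))

/-! ### Reduction of the double integral to the energy. -/

/-- The change of variables `(h, y) ↦ (h + y, y)`. -/
def shear : E3 × E3 ≃ᵐ E3 × E3 where
  toFun q := (q.1 + q.2, q.2)
  invFun q := (q.1 - q.2, q.2)
  left_inv q := by simp
  right_inv q := by simp
  measurable_toFun := by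
    simp only [Equiv.coe_fn_mk]
    fun_prop
  measurable_invFun := by
    simp only [Equiv.coe_fn_symm_mk]
    fun_prop

/-- The two differences are related by multiplication by a phase of modulus 1. -/
lemma gagliardoIntegrand_shear (m : ℝ) (A : E3 → E3) (s : ℝ) (u : E3 → ℂ) (h y : E3) :
    gagliardoIntegrand m A s u (h + y, y) =
      macdonaldKernel m ((3 + 2 * s) / 2) h * ‖covariantDiff A u h y‖ ^ 2 := by
  have hn : ‖covariantDiff A u h y‖ = ‖u (h + y) - phase (midpointPhase A h y) * u y‖ := by
    have : phase (midpointPhase A h y) * covariantDiff A u h y =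
        u (h + y) - phase (midpointPhase A h y) * u y := by
      rw [covariantDiff, mul_sub, ← mul_assoc, phase_mul_phase_neg, one_mul, add_comm y h]
    rw [← this, norm_mul, norm_phase, one_mul]
  rw [hn]
  simp only [gagliardoIntegrand, macdonaldKernel, phase, midpointPhase, add_sub_cancel_right,
    add_comm y h]
  ring

lemma macdonaldKernel_eq_of_norm_eq (m ν : ℝ) (h h' : E3) (hh : ‖h‖ = ‖h'‖) :
    macdonaldKernel m ν h = macdonaldKernel m ν h' := by
  rw [macdonaldKernel, macdonaldKernel, hh]

lemma measurable_kernel_covariantDiff {m ν : ℝ} {A : E3 → E3} (hA : Continuous A)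
    {u : E3 → ℂ} (hu : StronglyMeasurable u) :
    Measurable fun q : E3 × E3 =>
      macdonaldKernel m ν q.1 * ‖covariantDiff A u q.1 q.2‖ ^ 2 :=
  ((measurable_macdonaldKernel m ν).comp measurable_fst).mul
    ((measurable_covariantDiff hA hu).norm.pow_const 2)

lemma measurable_energy {A : E3 → E3} (hA : Continuous A) {u : E3 → ℂ}
    (hu : StronglyMeasurable u) :
    Measurable fun h : E3 => ∫ y, ‖covariantDiff A u h y‖ ^ 2 :=
  (StronglyMeasurable.integral_prod_right'
    ((measurable_covariantDiff hA hu).norm.pow_const 2).stronglyMeasurable).measurable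

lemma abs_kernel_mul_sub_le {k : E3 → ℝ} (hk0 : ∀ h, 0 ≤ k h) {a b : ℝ} {f g : E3 → ℝ}
    (hfg : ∀ h : E3, |f h - g h| ≤ a * ‖h‖ ^ 2 + b * ‖h‖ ^ 4) (h : E3) :
    |k h * f h - k h * g h| ≤ a * (k h * ‖h‖ ^ 2) + b * (k h * ‖h‖ ^ 4) := by
  rw [← mul_sub, abs_mul, abs_of_nonneg (hk0 h)]
  calc k h * |f h - g h| ≤ k h * (a * ‖h‖ ^ 2 + b * ‖h‖ ^ 4) :=
        mul_le_mul_of_nonneg_left (hfg h) (hk0 h)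
    _ = _ := by ring

/-- The comparison with `ε = 1` dominates the difference from the directional energy by second and
fourth moments, both finite for `s < 1`. -/
lemma integrable_kernel_energy {A : E3 → E3} {L : NNReal} (hA : LipschitzWith L A)
    {u : E3 → ℂ} {G : E3 → EuclideanSpace ℂ (Fin 3)}
    (hu : StronglyMeasurable u) (hG : StronglyMeasurable G) (hw : HasWeakGradient u G)
    (hu2 : MemLp u 2 volume) (hD : MemLp (covariantGradient A u G) 2 volume)
    (hDm : StronglyMeasurable (covariantGradient A u G))
    {m s : ℝ} (hm : 0 < m) (hs : s < 1) :
    Integrable (fun h => macdonaldKernel m ((3 + 2 * s) / 2) h *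
      ∫ y, ‖covariantDiff A u h y‖ ^ 2) volume := by
  obtain ⟨C, -, hC⟩ := abs_energy_sub_le hA hu hG hw hu2 hD hDm one_pos
  have hk := measurable_macdonaldKernel m ((3 + 2 * s) / 2)
  have hQ := (integral_radial_energy hk (macdonaldKernel_eq_of_norm_eq _ _)
    (integrable_kernel_sq hm hs) hD).1
  have hbound := ((integrable_kernel_sq hm hs).const_mul 1).add
    ((integrable_kernel_four hm hs).const_mul C)
  have hmeas := (hk.mul (measurable_energy hA.continuous hu)).aestronglyMeasurable (μ := volume)
  have hdiff := hbound.mono' (hmeas.sub hQ.1) (Eventually.of_forall fun h =>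
    abs_kernel_mul_sub_le (macdonaldKernel_nonneg hm _) hC h)
  refine (hdiff.add hQ).congr (Eventually.of_forall fun h => ?_)
  simp

lemma integrable_gagliardoIntegrand {A : E3 → E3} {L : NNReal} (hA : LipschitzWith L A)
    {u : E3 → ℂ} {G : E3 → EuclideanSpace ℂ (Fin 3)}
    (hu : StronglyMeasurable u) (hG : StronglyMeasurable G) (hw : HasWeakGradient u G)
    (hu2 : MemLp u 2 volume) (hD : MemLp (covariantGradient A u G) 2 volume)
    (hDm : StronglyMeasurable (covariantGradient A u G))
    {m s : ℝ} (hm : 0 < m) (hs : s < 1) :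
    Integrable (gagliardoIntegrand m A s u) (volume.prod volume) ∧
    ∫ p, gagliardoIntegrand m A s u p ∂(volume.prod volume) =
      ∫ h, macdonaldKernel m ((3 + 2 * s) / 2) h * ∫ y, ‖covariantDiff A u h y‖ ^ 2 := by
  set k := macdonaldKernel m ((3 + 2 * s) / 2) with hk
  have hk0 : ∀ h, 0 ≤ k h := macdonaldKernel_nonneg hm _
  have hprod : Integrable (fun q : E3 × E3 => k q.1 * ‖covariantDiff A u q.1 q.2‖ ^ 2)
      (volume.prod volume) := by
    rw [integrable_prod_iff
      (measurable_kernel_covariantDiff hA.continuous hu).aestronglyMeasurable]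
    refine ⟨Eventually.of_forall fun h => ?_, ?_⟩
    · exact ((memLp_covariantDiff hA.continuous hu hu2 h).integrable_norm_pow
        two_ne_zero).const_mul (k h)
    · refine (integrable_kernel_energy hA hu hG hw hu2 hD hDm hm hs).congr
        (Eventually.of_forall fun h => ?_)
      simp only [← integral_const_mul]
      refine integral_congr_ae (Eventually.of_forall fun y => ?_)
      exact (Real.norm_of_nonneg (mul_nonneg (hk0 h) (sq_nonneg _))).symm
  have hmp : MeasurePreserving shear (volume.prod volume)
      ((volume : Measure E3).prod volume) := measurePreserving_add_prod volume volume
  have hcomp : gagliardoIntegrand m A s u ∘ shear =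
      fun q : E3 × E3 => k q.1 * ‖covariantDiff A u q.1 q.2‖ ^ 2 :=
    funext fun q => gagliardoIntegrand_shear m A s u q.1 q.2
  constructor
  · rw [← hmp.integrable_comp_emb shear.measurableEmbedding, hcomp]
    exact hprod
  · rw [← hmp.integral_comp shear.measurableEmbedding]
    have e : ∀ q, gagliardoIntegrand m A s u (shear q) =
        k q.1 * ‖covariantDiff A u q.1 q.2‖ ^ 2 := fun q => congrFun hcomp q
    simp_rw [e]
    rw [integral_prod _ hprod]
    simp_rw [integral_const_mul]

/-! ### Passage to the limit. -/

lemma bbmConst_nonneg {s : ℝ} (hs : s ∈ Set.Ioo (0 : ℝ) 1) : 0 ≤ bbmConst s := by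
  have : 0 < Real.Gamma (1 - s) := Real.Gamma_pos_of_pos (by linarith [hs.2])
  have := hs.1
  unfold bbmConst
  positivity

lemma tendsto_normalized_energy {A : E3 → E3} {L : NNReal} (hA : LipschitzWith L A)
    {u : E3 → ℂ} {G : E3 → EuclideanSpace ℂ (Fin 3)}
    (hu : StronglyMeasurable u) (hG : StronglyMeasurable G) (hw : HasWeakGradient u G)
    (hu2 : MemLp u 2 volume) (hD : MemLp (covariantGradient A u G) 2 volume)
    (hDm : StronglyMeasurable (covariantGradient A u G))
    {m : ℝ} (hm : 0 < m) :
    Tendsto (fun s : ℝ => bbmConst s / 2 * m ^ ((3 + 2 * s) / 2) *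
      ∫ h, macdonaldKernel m ((3 + 2 * s) / 2) h * ∫ y, ‖covariantDiff A u h y‖ ^ 2)
      (𝓝[<] 1) (𝓝 (∫ x, ‖covariantGradient A u G x‖ ^ 2)) := by
  set D := covariantGradient A u G with hDdef
  set E₀ : ℝ := ∫ x, ‖D x‖ ^ 2 with hE₀
  set c : ℝ → ℝ := fun s => bbmConst s / 2 * m ^ ((3 + 2 * s) / 2) with hc
  set k : ℝ → E3 → ℝ := fun s => macdonaldKernel m ((3 + 2 * s) / 2) with hk
  have h2 : Tendsto (fun s => c s * ∫ h, k s h * ‖h‖ ^ 2) (𝓝[<] 1) (𝓝 3) :=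
    tendsto_normalized_second_moment hm
  have h4 : Tendsto (fun s => c s * ∫ h, k s h * ‖h‖ ^ 4) (𝓝[<] 1) (𝓝 0) :=
    tendsto_normalized_fourth_moment hm
  have hIoo : ∀ᶠ s : ℝ in 𝓝[<] 1, s ∈ Set.Ioo (0 : ℝ) 1 := Ioo_mem_nhdsLT one_pos
  have hQ : ∀ s < 1, Integrable (fun h => k s h * ∫ x, ‖dirPairing h (D x)‖ ^ 2) volume ∧
      ∫ h, k s h * ∫ x, ‖dirPairing h (D x)‖ ^ 2 = (∫ h, k s h * ‖h‖ ^ 2) / 3 * E₀ :=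
    fun s hs => integral_radial_energy (measurable_macdonaldKernel m _)
      (macdonaldKernel_eq_of_norm_eq _ _) (integrable_kernel_sq hm hs) hD
  have hQlim : Tendsto (fun s => c s * ∫ h, k s h * ∫ x, ‖dirPairing h (D x)‖ ^ 2) (𝓝[<] 1)
      (𝓝 E₀) := by
    have h5 := (h2.div_const 3).mul_const E₀
    rw [div_self three_ne_zero, one_mul] at h5
    refine h5.congr' ?_
    filter_upwards [self_mem_nhdsWithin] with s hs
    rw [(hQ s hs).2]
    ring
  have hdiff : Tendsto (fun s => c s * (∫ h, k s h * ∫ y, ‖covariantDiff A u h y‖ ^ 2) -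
      c s * ∫ h, k s h * ∫ x, ‖dirPairing h (D x)‖ ^ 2) (𝓝[<] 1) (𝓝 0) := by
    rw [Metric.tendsto_nhds]
    intro ε hε
    -- The error bound tends to `3ε/8`, leaving room below `ε`; `C` depends on `ε` but not on `s`.
    obtain ⟨C, -, hC⟩ := abs_energy_sub_le hA hu hG hw hu2 hD hDm (show 0 < ε / 8 by positivity)
    have h6 : Tendsto (fun s => ε / 8 * (c s * ∫ h, k s h * ‖h‖ ^ 2) +
        C * (c s * ∫ h, k s h * ‖h‖ ^ 4)) (𝓝[<] 1) (𝓝 (ε / 8 * 3 + C * 0)) :=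
      (h2.const_mul _).add (h4.const_mul _)
    filter_upwards [hIoo, h6.eventually_lt_const (show ε / 8 * 3 + C * 0 < ε by linarith)]
      with s hs hlt
    have hcs : 0 ≤ c s := mul_nonneg (div_nonneg (bbmConst_nonneg hs) two_pos.le)
      (Real.rpow_nonneg hm.le _)
    have hI2 := integrable_kernel_sq hm hs.2
    have hI4 := integrable_kernel_four hm hs.2
    have hIP := integrable_kernel_energy hA hu hG hw hu2 hD hDm hm hs.2
    have hIQ := (hQ s hs.2).1
    rw [dist_zero_right, Real.norm_eq_abs, ← mul_sub, abs_mul, abs_of_nonneg hcs,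
      ← integral_sub hIP hIQ]
    refine lt_of_le_of_lt ?_ hlt
    calc c s * |∫ h, (k s h * (∫ y, ‖covariantDiff A u h y‖ ^ 2) -
          k s h * ∫ x, ‖dirPairing h (D x)‖ ^ 2)|
        ≤ c s * ∫ h, (ε / 8 * (k s h * ‖h‖ ^ 2) + C * (k s h * ‖h‖ ^ 4)) := by
          refine mul_le_mul_of_nonneg_left (abs_integral_le_integral_abs.trans ?_) hcs
          exact integral_mono (hIP.sub hIQ).abs ((hI2.const_mul _).add (hI4.const_mul _))
            fun h => abs_kernel_mul_sub_le (macdonaldKernel_nonneg hm _) hC h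
      _ = _ := by
          rw [integral_add (hI2.const_mul _) (hI4.const_mul _), integral_const_mul,
            integral_const_mul]
          ring
  have := hdiff.add hQlim
  simpa using this

/-! ### Independence of the chosen representatives. -/

lemma HasWeakGradient.congr {u v : E3 → ℂ} {G F : E3 → EuclideanSpace ℂ (Fin 3)}
    (hw : HasWeakGradient u G) (huv : u =ᵐ[volume] v) (hGF : G =ᵐ[volume] F) :
    HasWeakGradient v F := by
  refine ⟨hw.1.congr huv, hw.2.1.congr hGF, fun φ hφ hc j => ?_⟩
  have h1 : ∫ x, ((fderiv ℝ φ x (EuclideanSpace.single j 1) : ℝ) : ℂ) * u x =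
      ∫ x, ((fderiv ℝ φ x (EuclideanSpace.single j 1) : ℝ) : ℂ) * v x :=
    integral_congr_ae (huv.mono fun x hx => by simp only [hx])
  have h2 : ∫ x, (φ x : ℂ) * G x j = ∫ x, (φ x : ℂ) * F x j :=
    integral_congr_ae (hGF.mono fun x hx => by simp only [hx])
  rw [← h1, ← h2]
  exact hw.2.2 φ hφ hc j

/-- Both gradients have the same pairing with every test function, coordinate by coordinate. This
allows an arbitrary `G` in the conclusion of `mainTheorem2`. -/
lemma HasWeakGradient.ae_unique {u : E3 → ℂ} {G F : E3 → EuclideanSpace ℂ (Fin 3)}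
    (hG : HasWeakGradient u G) (hF : HasWeakGradient u F) : G =ᵐ[volume] F := by
  have hcoord : ∀ j : Fin 3, ∀ᵐ x, dirPairing (EuclideanSpace.single j 1) (G x) =
      dirPairing (EuclideanSpace.single j 1) (F x) := fun j =>
    ae_eq_of_integral_contDiff_smul_eq (locallyIntegrable_dirPairing hG.2.1 _)
      (locallyIntegrable_dirPairing hF.2.1 _) fun φ hφ hc => by
        have h1 := integral_fderiv_smul_eq hG hφ hc (EuclideanSpace.single j 1)
        rw [integral_fderiv_smul_eq hF hφ hc] at h1
        exact (neg_injective h1).symm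
  filter_upwards [ae_all_iff.2 hcoord] with x hx
  ext j
  simpa [dirPairing, Pi.single_apply, apply_ite Complex.ofReal] using hx j

lemma covariantGradient_congr (A : E3 → E3) {u v : E3 → ℂ}
    {G F : E3 → EuclideanSpace ℂ (Fin 3)} (huv : u =ᵐ[volume] v) (hGF : G =ᵐ[volume] F) :
    covariantGradient A u G =ᵐ[volume] covariantGradient A v F := by
  filter_upwards [huv, hGF] with x hx hx'
  simp only [covariantGradient, hx, hx']

lemma stronglyMeasurable_covariantGradient {A : E3 → E3} (hA : Continuous A) {u : E3 → ℂ}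
    {G : E3 → EuclideanSpace ℂ (Fin 3)} (hu : StronglyMeasurable u) (hG : StronglyMeasurable G) :
    StronglyMeasurable (covariantGradient A u G) := by
  have hum := hu.measurable
  have hGm := hG.measurable
  have hAm := hA.measurable
  apply Measurable.stronglyMeasurable
  unfold covariantGradient
  refine (WithLp.measurable_toLp 2 _).comp (measurable_pi_lambda _ fun j => ?_)
  fun_prop

lemma gagliardoIntegrand_congr (m : ℝ) (A : E3 → E3) (s : ℝ) {u v : E3 → ℂ}
    (huv : u =ᵐ[volume] v) :
    gagliardoIntegrand m A s u =ᵐ[volume.prod volume] gagliardoIntegrand m A s v := by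
  filter_upwards [Measure.quasiMeasurePreserving_fst.ae huv,
    Measure.quasiMeasurePreserving_snd.ae huv] with p hp hp'
  simp only [gagliardoIntegrand, hp, hp']

end MagneticBBM

end

theorem mainTheorem2 (m : ℝ) (hm : 0 < m)
    (A : MagneticBBM.E3 → MagneticBBM.E3) (hA : ∃ L, LipschitzWith L A)
    (u : MagneticBBM.E3 → ℂ) (hu : u ∈ MagneticBBM.magneticH1 A) :
    (∀ s ∈ Set.Ioo (0 : ℝ) 1, Integrable (MagneticBBM.gagliardoIntegrand m A s u) volume) ∧
    ∀ G, MagneticBBM.HasWeakGradient u G →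
      Tendsto
        (fun s : ℝ => MagneticBBM.bbmConst s / 2 * m ^ ((3 + 2 * s) / 2) *
          ∫ p : MagneticBBM.E3 × MagneticBBM.E3, MagneticBBM.gagliardoIntegrand m A s u p)
        (𝓝[<] 1)
        (𝓝 (∫ x, ‖MagneticBBM.covariantGradient A u G x‖ ^ 2)) := by
  obtain ⟨L, hA⟩ := hA
  obtain ⟨hu2, G₀, hw₀, hD₀⟩ := hu
  -- Strongly measurable representatives of `u` and its gradient are used throughout; every quantity
  -- in the statement depends only on almost-everywhere classes.
  obtain ⟨v, hv, huv⟩ := hu2.1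
  obtain ⟨F, hF, hGF⟩ := hw₀.2.1.aestronglyMeasurable
  have hw := hw₀.congr huv hGF
  have hv2 := (memLp_congr_ae huv).1 hu2
  have hD := (memLp_congr_ae (MagneticBBM.covariantGradient_congr A huv hGF)).1 hD₀
  have hDm := MagneticBBM.stronglyMeasurable_covariantGradient hA.continuous hv hF
  have hcongr := fun s => MagneticBBM.gagliardoIntegrand_congr m A s huv
  refine ⟨fun s hs => ?_, fun G hG => ?_⟩
  · exact (MagneticBBM.integrable_gagliardoIntegrand hA hv hF hw hv2 hD hDm hm hs.2).1.congr
      (hcongr s).symm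
  · have hlim := MagneticBBM.tendsto_normalized_energy hA hv hF hw hv2 hD hDm hm
    have hGG := MagneticBBM.covariantGradient_congr A huv ((hG.ae_unique hw₀).trans hGF)
    have hE : ∫ x, ‖MagneticBBM.covariantGradient A u G x‖ ^ 2 =
        ∫ x, ‖MagneticBBM.covariantGradient A v F x‖ ^ 2 :=
      integral_congr_ae (hGG.mono fun x hx => by simp only [hx])
    rw [hE]
    refine hlim.congr' ?_
    filter_upwards [self_mem_nhdsWithin] with s hs
    rw [← (MagneticBBM.integrable_gagliardoIntegrand hA hv hF hw hv2 hD hDm hm hs).2]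
    exact congrArg _ (integral_congr_ae (hcongr s).symm)
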